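/- Let $\lambda\in\mathbb C$ with $|\lambda|>1$, let $p,q\in\mathbb C[x]$ be polynomials with $p(0)=0$, $p'(0)=\lambda$, $q(0)=0$, $q'(0)\neq 0$, and let $$F:\mathbb C^2\to\mathbb C^2,\qquad F(t,z)=\left(\tfrac{t}{\lambda},\,p(z)+q(t)\right).$$ Let $x_0\in\mathbb C$ be a critical point of $p$ of order at least $3$ (a zero of $p'$ of multiplicity at least $3$) with $p^k(x_0)=0$ for some $k\in\mathbb N$, where $p^k$ is the $k$-th iterate. For $n,j\in\mathbb N$ put $\varphi_{n,j}(w)=\pi_2F^j\left(\tfrac{w}{\lambda^n},x_0\right)$, a polynomial in $w$ ($\pi_2$ is the projection to the $z$-coordinate). For $j\ge k$ the quadratic term of $\varphi_{n,j}$ has the form $$w^2\left(X_2\lambda^{-2n+2j}+X_1\lambda^{-2n+j}+X_0\lambda^{-2n}+X_{-1}\lambda^{-2n-j}+X_{-2}\lambda^{-2n-2j}\right)$$ with unique constants $X_i$ independent of $n$ and $j$. Assume that $F$ is a degenerate resonant skew-product, that is, $X_1=0$. Let $w_0\in\mathbb C$ be such that $\varphi_{n,n}(w_0)\to x_0$ as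 $n\to\infty$, and put $$D_n=\left\{\left(\tfrac{w_0}{\lambda^n},z\right)\;:\;|z-x_0|<|\lambda|^{-3n/4}\right\}.$$ Then there is an $N\in\mathbb N$ such that for every $n\ge N$ the disk $D_n$ is a Fatou disk for $F$, that is, $D_n$ is a holomorphic disk (the image of the open unit disk under a holomorphic embedding into $\mathbb C^2$) and the family $\{F^j|_{D_n}\}_{j\in\mathbb N}$ is normal: every sequence of its members has a subsequence that converges locally uniformly on $D_n$ to a map into $\mathbb C^2$. Moreover, for every $n\ge N$, the $t$-coordinates of $F^j$ tend to $0$ uniformly on $D_n$ as $j\to\infty$, and the $z$-coordinates of $F^j$ on $D_n$ are bounded uniformly in $j$ and in the point of $D_n$. -/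

import Mathlib

open Filter Topology

/-- The skew-product `F(t, z) = (t / lam, p(z) + q(t))` of `ℂ²`. -/
noncomputable def skewProduct (lam : ℂ) (p q : Polynomial ℂ) : ℂ × ℂ → ℂ × ℂ :=
  fun P => (P.1 / lam, p.eval P.2 + q.eval P.1)

/-- `φ_{n,j}(w) = π₂ (F^j (w / lam ^ n, x₀))`. -/
noncomputable def phi (lam : ℂ) (p q : Polynomial ℂ) (x₀ : ℂ) (n j : ℕ) (w : ℂ) : ℂ :=
  ((skewProduct lam p q)^[j] (w / lam ^ n, x₀)).2

/-- `φ_{n,j}` as a polynomial in `w`; see `phiPoly_eval`. -/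
noncomputable def phiPoly (lam : ℂ) (p q : Polynomial ℂ) (x₀ : ℂ) (n : ℕ) : ℕ → Polynomial ℂ
  | 0 => Polynomial.C x₀
  | j + 1 => p.comp (phiPoly lam p q x₀ n j)
      + q.comp (Polynomial.C ((lam ^ (n + j))⁻¹) * Polynomial.X)

theorem skewProduct_iterate_fst (lam : ℂ) (p q : Polynomial ℂ) (j : ℕ) (P : ℂ × ℂ) :
    ((skewProduct lam p q)^[j] P).1 = P.1 / lam ^ j := by
  induction j with
  | zero => simp
  | succ j ih =>
    rw [Function.iterate_succ_apply']
    simp only [skewProduct] at ih ⊢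
    rw [ih, pow_succ, div_div]

theorem phiPoly_eval (lam : ℂ) (p q : Polynomial ℂ) (x₀ : ℂ) (n j : ℕ) (w : ℂ) :
    (phiPoly lam p q x₀ n j).eval w = phi lam p q x₀ n j w := by
  induction j with
  | zero => simp [phiPoly, phi]
  | succ j ih =>
    have h := skewProduct_iterate_fst lam p q j (w / lam ^ n, x₀)
    unfold phi at ih ⊢
    rw [Function.iterate_succ_apply']
    simp only [phiPoly, Polynomial.eval_add, Polynomial.eval_comp, ih, Polynomial.eval_mul,
      Polynomial.eval_C, Polynomial.eval_X]
    conv_rhs => unfold skewProduct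
    simp only
    change _ = Polynomial.eval ((skewProduct lam p q)^[j] (w / lam ^ n, x₀)).2 p
      + Polynomial.eval ((skewProduct lam p q)^[j] (w / lam ^ n, x₀)).1 q
    rw [h, div_div, ← pow_add, mul_comm _ w, ← div_eq_mul_inv]

/-- `F` is a degenerate resonant skew-product (relative to `x₀` with `p^k(x₀) = 0`):
for `j ≥ k` the quadratic term in `w` of `φ_{n,j}` has the closed form
`w² (X₂ lam^(-2n+2j) + X₁ lam^(-2n+j) + X₀ lam^(-2n) + X₋₁ lam^(-2n-j) + X₋₂ lam^(-2n-2j))`,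
with constants independent of `n` and `j`, and `X₁ = 0`. For `|lam| > 1` the five exponentials
in `j` are linearly independent, so the constants are unique. -/
def IsDegenerateResonant (lam : ℂ) (p q : Polynomial ℂ) (x₀ : ℂ) (k : ℕ) : Prop :=
  ∃ X₂ X₁ X₀ Y₁ Y₂ : ℂ,
    (∀ n j : ℕ, k ≤ j →
      (phiPoly lam p q x₀ n j).coeff 2 =
        X₂ * lam ^ (-2 * (n : ℤ) + 2 * (j : ℤ)) + X₁ * lam ^ (-2 * (n : ℤ) + (j : ℤ))
          + X₀ * lam ^ (-2 * (n : ℤ)) + Y₁ * lam ^ (-2 * (n : ℤ) - (j : ℤ))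
          + Y₂ * lam ^ (-2 * (n : ℤ) - 2 * (j : ℤ))) ∧
    X₁ = 0

/-- The vertical disk `D_n = {(w₀ / lam^n, z) : |z - x₀| < |lam|^(-3n/4)}`. -/
def verticalDisk (lam w₀ x₀ : ℂ) (n : ℕ) : Set (ℂ × ℂ) :=
  {P | P.1 = w₀ / lam ^ n ∧ ‖P.2 - x₀‖ < ‖lam‖ ^ (-(3 * (n : ℝ) / 4))}

/-- An (embedded) holomorphic disk in `ℂ²`: the image of the open unit disk under a holomorphic
immersion that is a homeomorphism onto its image. -/
def IsHolomorphicDisk (D : Set (ℂ × ℂ)) : Prop :=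
  ∃ h : ℂ → ℂ × ℂ,
    DifferentiableOn ℂ h (Metric.ball 0 1) ∧
    (∀ ζ ∈ Metric.ball (0 : ℂ) 1, deriv h ζ ≠ 0) ∧
    IsEmbedding ((Metric.ball (0 : ℂ) 1).domRestrict h) ∧
    h '' Metric.ball (0 : ℂ) 1 = D

/-- The family `{f^j restricted to D}` is normal: every sequence of its members has a subsequence
that converges locally uniformly on `D` to a map into `ℂ²` (divergence to infinity is not
admitted). -/
def IteratesNormalOn (f : ℂ × ℂ → ℂ × ℂ) (D : Set (ℂ × ℂ)) : Prop :=
  ∀ s : ℕ → ℕ, ∃ σ : ℕ → ℕ, StrictMono σ ∧ ∃ G : ℂ × ℂ → ℂ × ℂ,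
    TendstoLocallyUniformlyOn (fun i => f^[s (σ i)]) G atTop D

/-- `D` is a Fatou disk for `f`: a holomorphic disk on which the iterates of `f` are normal. -/
def IsFatouDisk (f : ℂ × ℂ → ℂ × ℂ) (D : Set (ℂ × ℂ)) : Prop :=
  IsHolomorphicDisk D ∧ IteratesNormalOn f D

/-! The disk `D_n` is carried into `D_{2n}` by `F^n` for every large `n`, so its orbit passes
through `D_n`, `D_{2n}`, `D_{4n}`, …. In between it stays in a bounded set, and its vertical
diameter tends to zero. Normality then follows by compactness.

Two estimates give the inclusion. First, `p - p(x₀)` vanishes to order four at `x₀`, so one step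
shrinks the radius `|λ|^(-3n/4)` to order `|λ|^(-3n)`. The following steps expand by at most `μ`,
slightly more than `|λ|`, except for a bounded number far from `0`. After `n` steps the image has
radius of order `(μ/|λ|^3)^n`, against the radius `|λ|^(-3n/2)` of `D_{2n}`.

Second, the orbit of the centre must return to `x₀` at the same rate
(`exists_fiberOrbit_estimates`). With `G_j(t) = π₂ F^j(t, x₀)`, one compares `G_{j+1}(t/λ)` with
`G_j(t)` for `t` of order `λ^(-j)`. The linear parts differ by `O(|λ|^(-2j))`, the cubic remainders
by `O(μ^j |λ|^(-3j))`. The quadratic parts would differ by order `|λ|^(-j)`, too much, were it not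
for `X₁ = 0`, which leaves `O(|λ|^(-2j))`. Consecutive returns thus differ by a geometric sequence,
and the assumed limit `x₀` turns this into a rate (`exists_norm_eval_succ_sub_le`). -/

/-! ### Local estimates and low-order coefficients of polynomials. -/

namespace Polynomial

theorem exists_norm_eval_le (p : Polynomial ℂ) (R : ℝ) :
    ∃ C : ℝ, 1 ≤ C ∧ ∀ z : ℂ, ‖z‖ ≤ R → ‖p.eval z‖ ≤ C := by
  obtain ⟨C, hC⟩ := (isCompact_closedBall (0 : ℂ) R).exists_bound_of_continuousOn
    p.continuous.continuousOn
  exact ⟨max C 1, le_max_right _ _, fun z hz => (hC z (by simpa using hz)).trans (le_max_left _ _)⟩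

theorem norm_eval_sub_le_of_norm_derivative_le (p : Polynomial ℂ) {R C : ℝ}
    (h : ∀ z : ℂ, ‖z‖ ≤ R → ‖p.derivative.eval z‖ ≤ C) (x y : ℂ) (hx : ‖x‖ ≤ R) (hy : ‖y‖ ≤ R) :
    ‖p.eval y - p.eval x‖ ≤ C * ‖y - x‖ :=
  (convex_closedBall (0 : ℂ) R).norm_image_sub_le_of_norm_hasDerivWithin_le
    (f := fun z => p.eval z) (f' := fun z => p.derivative.eval z)
    (fun z _ => (p.hasDerivAt z).hasDerivWithinAt) (fun z hz => h z (by simpa using hz))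
    (by simpa using hx) (by simpa using hy)

theorem exists_norm_eval_sub_le (p : Polynomial ℂ) (R : ℝ) :
    ∃ C : ℝ, 1 ≤ C ∧ ∀ x y : ℂ, ‖x‖ ≤ R → ‖y‖ ≤ R → ‖p.eval y - p.eval x‖ ≤ C * ‖y - x‖ := by
  obtain ⟨C, hC1, hC⟩ := p.derivative.exists_norm_eval_le R
  exact ⟨C, hC1, p.norm_eval_sub_le_of_norm_derivative_le hC⟩

theorem exists_norm_eval_sub_le_near_zero (p : Polynomial ℂ) {m : ℝ}
    (h : ‖p.derivative.eval 0‖ < m) :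
    ∃ r : ℝ, 0 < r ∧ ∀ x y : ℂ, ‖x‖ ≤ r → ‖y‖ ≤ r → ‖p.eval y - p.eval x‖ ≤ m * ‖y - x‖ := by
  have h1 : ∀ᶠ z in 𝓝 (0 : ℂ), ‖p.derivative.eval z‖ < m :=
    (p.derivative.continuous.norm.tendsto 0).eventually_lt_const h
  obtain ⟨r, hr, hr'⟩ := Metric.nhds_basis_closedBall.eventually_iff.mp h1
  exact ⟨r, hr, p.norm_eval_sub_le_of_norm_derivative_le fun z hz =>
    (hr' (by simpa using hz)).le⟩

theorem eq_jet_two (p : Polynomial ℂ) (h0 : p.coeff 0 = 0) :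
    p = X * (C (p.coeff 1) + X * (C (p.coeff 2) + X * p.divX.divX.divX)) := by
  have h1 := p.divX_mul_X_add
  have h2 := p.divX.divX_mul_X_add
  have h3 := p.divX.divX.divX_mul_X_add
  simp only [coeff_divX] at h2 h3
  norm_num at h2 h3
  rw [h0, C_0, add_zero] at h1
  conv_lhs => rw [← h1, ← h2, ← h3]
  ring

theorem eval_eq_jet_two (p : Polynomial ℂ) (h0 : p.coeff 0 = 0) (z : ℂ) :
    p.eval z = p.coeff 1 * z + p.coeff 2 * z ^ 2 + z ^ 3 * p.divX.divX.divX.eval z := by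
  conv_lhs => rw [p.eq_jet_two h0]
  simp only [eval_mul, eval_X, eval_add, eval_C]
  ring

theorem coeff_one_comp (p g : Polynomial ℂ) (hp : p.coeff 0 = 0) (hg : g.coeff 0 = 0) :
    (p.comp g).coeff 1 = p.coeff 1 * g.coeff 1 := by
  have hgX : g = X * g.divX := by
    have := g.divX_mul_X_add
    rw [hg, C_0, add_zero] at this
    rw [mul_comm]; exact this.symm
  have h : p.comp g = X * (C (p.coeff 1) * g.divX + X * (C (p.coeff 2) * g.divX ^ 2
      + X * (g.divX ^ 3 * p.divX.divX.divX.comp g))) := by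
    conv_lhs => rw [p.eq_jet_two hp]
    simp only [mul_comp, X_comp, add_comp, C_comp]
    linear_combination (C (p.coeff 1) + C (p.coeff 2) * (g + X * g.divX)
      + p.divX.divX.divX.comp g * (g ^ 2 + g * (X * g.divX) + (X * g.divX) ^ 2)) * hgX
  rw [h, coeff_X_mul]
  simp [mul_coeff_zero, coeff_divX]

theorem coeff_two_comp (p g : Polynomial ℂ) (hp : p.coeff 0 = 0) (hg : g.coeff 0 = 0) :
    (p.comp g).coeff 2 = p.coeff 1 * g.coeff 2 + p.coeff 2 * g.coeff 1 ^ 2 := by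
  have hgX : g = X * g.divX := by
    have := g.divX_mul_X_add
    rw [hg, C_0, add_zero] at this
    rw [mul_comm]; exact this.symm
  have h : p.comp g = X * (C (p.coeff 1) * g.divX + X * (C (p.coeff 2) * g.divX ^ 2
      + X * (g.divX ^ 3 * p.divX.divX.divX.comp g))) := by
    conv_lhs => rw [p.eq_jet_two hp]
    simp only [mul_comp, X_comp, add_comp, C_comp]
    linear_combination (C (p.coeff 1) + C (p.coeff 2) * (g + X * g.divX)
      + p.divX.divX.divX.comp g * (g ^ 2 + g * (X * g.divX) + (X * g.divX) ^ 2)) * hgX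
  rw [h, coeff_X_mul, coeff_add, coeff_C_mul, coeff_X_mul]
  simp [mul_coeff_zero, coeff_divX, pow_two]

/-- Differentiation lowers the multiplicity of a root by exactly one, so a triple zero of the
derivative gives fourth-order contact. -/
theorem exists_eval_sub_eq_pow_four_mul (p : Polynomial ℂ) (x : ℂ)
    (h : 3 ≤ p.derivative.rootMultiplicity x) :
    ∃ r : Polynomial ℂ, ∀ z, p.eval z - p.eval x = (z - x) ^ 4 * r.eval z := by
  have hroot : (p - C (p.eval x)).IsRoot x := by simp [IsRoot]
  have h1 := derivative_rootMultiplicity_of_root hroot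
  rw [derivative_sub, derivative_C, sub_zero] at h1
  have h2 : 4 ≤ (p - C (p.eval x)).rootMultiplicity x := by omega
  obtain ⟨r, hr⟩ := (pow_dvd_pow _ h2).trans (pow_rootMultiplicity_dvd (p - C (p.eval x)) x)
  refine ⟨r, fun z => ?_⟩
  have := congrArg (eval z) hr
  simpa using this

end Polynomial

-- Functions vanishing to third order have Lipschitz constant `O(s ^ 2)` on the disk of radius `s`;
-- this controls the differences of the higher-order terms of `p` and `q`.
open Polynomial in
theorem exists_norm_cubic_sub_le (P : Polynomial ℂ) (R : ℝ) :
    ∃ C : ℝ, 1 ≤ C ∧ ∀ (x y : ℂ) (s : ℝ), ‖x‖ ≤ s → ‖y‖ ≤ s → s ≤ R →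
      ‖y ^ 3 * P.eval y - x ^ 3 * P.eval x‖ ≤ C * s ^ 2 * ‖y - x‖ := by
  obtain ⟨B, hB1, hB⟩ := P.exists_norm_eval_le R
  obtain ⟨L, hL1, hL⟩ := P.exists_norm_eval_sub_le R
  refine ⟨3 * B + |R| * L, by nlinarith [abs_nonneg R], fun x y s hx hy hs => ?_⟩
  have hs0 : 0 ≤ s := (norm_nonneg x).trans hx
  have hRs : s ≤ |R| := hs.trans (le_abs_self R)
  have e : y ^ 3 * P.eval y - x ^ 3 * P.eval x
      = (y ^ 2 + y * x + x ^ 2) * P.eval y * (y - x) + x ^ 3 * (P.eval y - P.eval x) := by ring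
  have h1 : ‖y ^ 2 + y * x + x ^ 2‖ ≤ 3 * s ^ 2 := by
    calc ‖y ^ 2 + y * x + x ^ 2‖ ≤ ‖y ^ 2‖ + ‖y * x‖ + ‖x ^ 2‖ := norm_add₃_le
      _ = ‖y‖ ^ 2 + ‖y‖ * ‖x‖ + ‖x‖ ^ 2 := by simp
      _ ≤ s ^ 2 + s * s + s ^ 2 := by gcongr
      _ = 3 * s ^ 2 := by ring
  calc _ ≤ ‖y ^ 2 + y * x + x ^ 2‖ * ‖P.eval y‖ * ‖y - x‖
        + ‖x‖ ^ 3 * ‖P.eval y - P.eval x‖ := by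
        rw [e]
        refine (norm_add_le _ _).trans_eq ?_
        simp
    _ ≤ 3 * s ^ 2 * B * ‖y - x‖ + s ^ 3 * (L * ‖y - x‖) := by
        gcongr
        · exact hB y (hy.trans hs)
        · exact hL x y (hx.trans hs) (hy.trans hs)
    _ ≤ 3 * s ^ 2 * B * ‖y - x‖ + (s ^ 2 * |R|) * (L * ‖y - x‖) := by
        gcongr
        calc s ^ 3 = s ^ 2 * s := by ring
          _ ≤ _ := by gcongr
    _ = _ := by ring

/-! ### Iterates of a curve through the fixed point. -/

open Polynomial in
/-- The polynomials `G j` (`j ≥ k`) parametrize the iterates under the skew-product of a curve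
through its fixed point `0`. -/
structure IsCurveOrbit (lam : ℂ) (p q : Polynomial ℂ) (k : ℕ) (G : ℕ → Polynomial ℂ) : Prop where
  one_lt : 1 < ‖lam‖
  p_zero : p.coeff 0 = 0
  p_one : p.coeff 1 = lam
  q_zero : q.coeff 0 = 0
  succ : ∀ j, G (j + 1) = p.comp (G j) + q.comp (C ((lam ^ j)⁻¹) * X)
  base : (G k).coeff 0 = 0

namespace IsCurveOrbit

variable {lam : ℂ} {p q : Polynomial ℂ} {k : ℕ} {G : ℕ → Polynomial ℂ}

theorem coeff_zero (h : IsCurveOrbit lam p q k G) {j : ℕ} (hj : k ≤ j) : (G j).coeff 0 = 0 := by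
  induction j, hj using Nat.le_induction with
  | base => exact h.base
  | succ j hj ih =>
    have hp := h.p_zero
    have hq := h.q_zero
    rw [Polynomial.coeff_zero_eq_eval_zero] at ih hp hq ⊢
    simp [h.succ, ih, hp, hq]

theorem coeff_one_succ (h : IsCurveOrbit lam p q k G) {j : ℕ} (hj : k ≤ j) :
    (G (j + 1)).coeff 1 = lam * (G j).coeff 1 + q.coeff 1 * (lam ^ j)⁻¹ := by
  rw [h.succ, Polynomial.coeff_add, p.coeff_one_comp _ h.p_zero (h.coeff_zero hj),
    q.coeff_one_comp _ h.q_zero (by simp), h.p_one]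
  simp

theorem coeff_two_succ (h : IsCurveOrbit lam p q k G) {j : ℕ} (hj : k ≤ j) :
    (G (j + 1)).coeff 2 = lam * (G j).coeff 2 + p.coeff 2 * (G j).coeff 1 ^ 2
      + q.coeff 2 * ((lam ^ j)⁻¹) ^ 2 := by
  rw [h.succ, Polynomial.coeff_add, p.coeff_two_comp _ h.p_zero (h.coeff_zero hj),
    q.coeff_two_comp _ h.q_zero (by simp), h.p_one]
  simp

theorem eval_succ (h : IsCurveOrbit lam p q k G) (j : ℕ) (t : ℂ) :
    (G (j + 1)).eval t = p.eval ((G j).eval t) + q.eval (t * (lam ^ j)⁻¹) := by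
  rw [h.succ, Polynomial.eval_add, Polynomial.eval_comp, Polynomial.eval_comp,
    Polynomial.eval_mul, Polynomial.eval_C, Polynomial.eval_X, mul_comm t]

theorem exists_norm_coeff_one_le (h : IsCurveOrbit lam p q k G) :
    ∃ A : ℝ, 0 ≤ A ∧ ∀ j, k ≤ j → ‖(G j).coeff 1‖ ≤ A * ‖lam‖ ^ j := by
  have hL := h.one_lt
  set e := ‖q.coeff 1‖ / (‖lam‖ - 1) with he
  have he0 : 0 ≤ e := div_nonneg (norm_nonneg _) (by linarith)
  have hee : e * (‖lam‖ - 1) = ‖q.coeff 1‖ := div_mul_cancel₀ _ (by linarith)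
  -- The correction `-e` absorbs the forcing by `q`: `e` solves `e * (‖lam‖ - 1) = ‖q.coeff 1‖`.
  have key : ∀ j, k ≤ j → ‖(G j).coeff 1‖ ≤ (‖(G k).coeff 1‖ + e) * ‖lam‖ ^ j - e := by
    intro j hj
    induction j, hj using Nat.le_induction with
    | base =>
      have : 1 ≤ ‖lam‖ ^ k := one_le_pow₀ hL.le
      nlinarith [norm_nonneg ((G k).coeff 1)]
    | succ j hj ih =>
      have h1 : (‖lam‖ ^ j)⁻¹ ≤ 1 := inv_le_one_of_one_le₀ (one_le_pow₀ hL.le)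
      calc ‖(G (j + 1)).coeff 1‖ ≤ ‖lam‖ * ‖(G j).coeff 1‖ + ‖q.coeff 1‖ * (‖lam‖ ^ j)⁻¹ := by
            rw [h.coeff_one_succ hj]
            refine (norm_add_le _ _).trans_eq ?_
            simp
        _ ≤ ‖lam‖ * ((‖(G k).coeff 1‖ + e) * ‖lam‖ ^ j - e) + ‖q.coeff 1‖ * 1 := by gcongr
        _ = _ := by rw [← hee, pow_succ]; ring
  exact ⟨‖(G k).coeff 1‖ + e, by positivity, fun j hj => (key j hj).trans (by linarith)⟩

/-- Closeness of the orbit of the curve to its tangent line, as long as it stays near `0`. -/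
theorem exists_norm_eval_sub_linear_le (h : IsCurveOrbit lam p q k G) :
    ∃ E : ℝ, 1 ≤ E ∧ ∀ j, k ≤ j → ∀ t : ℂ, E * (‖t‖ * ‖lam‖ ^ j) ≤ 1 →
      ‖(G j).eval t - (G j).coeff 1 * t‖ ≤ E * (‖t‖ * ‖lam‖ ^ j) ^ 2 := by
  have hL := h.one_lt
  obtain ⟨A, hA0, hA⟩ := h.exists_norm_coeff_one_le
  obtain ⟨Cp, hCp1, hCp⟩ := p.divX.divX.divX.exists_norm_eval_le (A + 1)
  obtain ⟨Cq, hCq1, hCq⟩ := q.divX.divX.divX.exists_norm_eval_le 1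
  obtain ⟨Ck, hCk1, hCk⟩ := (G k).divX.divX.divX.exists_norm_eval_le 1
  set Bp := ‖p.coeff 2‖ + (A + 1) * Cp with hBp
  set Bq := ‖q.coeff 2‖ + Cq with hBq
  -- The old error grows by `‖lam‖` per step, the allowed error by `‖lam‖ ^ 2`. The last entry makes
  -- the gap `E * (‖lam‖ ^ 2 - ‖lam‖)` large enough for the new second-order terms.
  set E := max 1 (max (‖(G k).coeff 2‖ + Ck)
    ((Bp * (A + 1) ^ 2 + Bq) / (‖lam‖ ^ 2 - ‖lam‖))) with hE
  have hE1 : 1 ≤ E := le_max_left _ _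
  have hEk : ‖(G k).coeff 2‖ + Ck ≤ E := (le_max_left _ _).trans (le_max_right _ _)
  have hEs : Bp * (A + 1) ^ 2 + Bq ≤ E * (‖lam‖ ^ 2 - ‖lam‖) := by
    rw [← div_le_iff₀ (by nlinarith)]
    exact (le_max_right _ _).trans (le_max_right _ _)
  refine ⟨E, hE1, fun j hj => ?_⟩
  induction j, hj using Nat.le_induction with
  | base =>
    intro t ht
    set τ := ‖t‖ * ‖lam‖ ^ k with hτ
    have hτ0 : 0 ≤ τ := by positivity
    have hτ1 : τ ≤ 1 := by nlinarith
    have htτ : ‖t‖ ≤ τ := le_mul_of_one_le_right (norm_nonneg _) (one_le_pow₀ hL.le)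
    have e : (G k).eval t - (G k).coeff 1 * t
        = (G k).coeff 2 * t ^ 2 + t ^ 3 * (G k).divX.divX.divX.eval t := by
      rw [(G k).eval_eq_jet_two h.base]; ring
    calc _ ≤ ‖(G k).coeff 2‖ * ‖t‖ ^ 2 + ‖t‖ ^ 3 * ‖(G k).divX.divX.divX.eval t‖ := by
          rw [e]
          refine (norm_add_le _ _).trans_eq ?_
          simp
      _ ≤ ‖(G k).coeff 2‖ * τ ^ 2 + τ ^ 2 * Ck := by
          gcongr
          · calc ‖t‖ ^ 3 = ‖t‖ ^ 2 * ‖t‖ := by ring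
              _ ≤ τ ^ 2 * 1 := by gcongr; linarith
              _ = τ ^ 2 := by ring
          · exact hCk t (by linarith)
      _ = (‖(G k).coeff 2‖ + Ck) * τ ^ 2 := by ring
      _ ≤ E * τ ^ 2 := by gcongr
  | succ j hj ih =>
    intro t ht
    have hs1 : 1 ≤ ‖lam‖ ^ j := one_le_pow₀ hL.le
    have hττ : ‖t‖ * ‖lam‖ ^ (j + 1) = ‖lam‖ * (‖t‖ * ‖lam‖ ^ j) := by rw [pow_succ]; ring
    rw [hττ] at ht ⊢
    set τ := ‖t‖ * ‖lam‖ ^ j with hτ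
    have hτ0 : 0 ≤ τ := by positivity
    have hEτ : E * τ ≤ 1 := by
      have : E * τ ≤ E * (‖lam‖ * τ) := by
        gcongr
        nlinarith
      linarith
    have hτ1 : τ ≤ 1 := by nlinarith
    have htτ : ‖t‖ ≤ τ := le_mul_of_one_le_right (norm_nonneg _) hs1
    have ih' := ih t hEτ
    set x := (G j).eval t with hx
    set a := (G j).coeff 1 with ha
    have hat : ‖a * t‖ ≤ A * τ := by
      rw [norm_mul]
      calc ‖a‖ * ‖t‖ ≤ (A * ‖lam‖ ^ j) * ‖t‖ := by gcongr; exact hA j hj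
        _ = A * τ := by rw [hτ]; ring
    have hxn : ‖x‖ ≤ (A + 1) * τ := by
      calc ‖x‖ = ‖(x - a * t) + a * t‖ := by ring_nf
        _ ≤ ‖x - a * t‖ + ‖a * t‖ := norm_add_le _ _
        _ ≤ E * τ ^ 2 + A * τ := by gcongr
        _ ≤ (A + 1) * τ := by nlinarith
    have hxA : ‖x‖ ≤ A + 1 := hxn.trans (by nlinarith)
    set u := t * (lam ^ j)⁻¹ with hu
    have hun : ‖u‖ ≤ τ := by
      rw [hu, norm_mul, norm_inv, norm_pow]
      refine le_trans ?_ htτ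
      exact mul_le_of_le_one_right (norm_nonneg _) (inv_le_one_of_one_le₀ hs1)
    have e : (G (j + 1)).eval t - (G (j + 1)).coeff 1 * t = lam * (x - a * t)
        + x ^ 2 * (p.coeff 2 + x * p.divX.divX.divX.eval x)
        + u ^ 2 * (q.coeff 2 + u * q.divX.divX.divX.eval u) := by
      rw [h.eval_succ, h.coeff_one_succ hj, p.eval_eq_jet_two h.p_zero,
        q.eval_eq_jet_two h.q_zero, h.p_one]
      simp only [← hx, ← ha, ← hu]
      rw [show (lam * a + q.coeff 1 * (lam ^ j)⁻¹) * t = lam * a * t + q.coeff 1 * u by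
        rw [hu]; ring]
      ring
    have hP : ‖p.coeff 2 + x * p.divX.divX.divX.eval x‖ ≤ Bp := by
      refine (norm_add_le _ _).trans ?_
      rw [norm_mul, hBp]
      gcongr
      exact hCp x hxA
    have hQ : ‖q.coeff 2 + u * q.divX.divX.divX.eval u‖ ≤ Bq := by
      refine (norm_add_le _ _).trans ?_
      rw [norm_mul]
      have h1 := hCq u (hun.trans hτ1)
      have h2 := hun.trans hτ1
      rw [hBq]
      have : ‖u‖ * ‖q.divX.divX.divX.eval u‖ ≤ 1 * Cq := by gcongr
      linarith
    calc _ ≤ ‖lam‖ * ‖x - a * t‖ + ‖x‖ ^ 2 * ‖p.coeff 2 + x * p.divX.divX.divX.eval x‖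
          + ‖u‖ ^ 2 * ‖q.coeff 2 + u * q.divX.divX.divX.eval u‖ := by
          rw [e]
          refine norm_add₃_le.trans_eq ?_
          simp only [norm_mul, norm_pow]
      _ ≤ ‖lam‖ * (E * τ ^ 2) + ((A + 1) * τ) ^ 2 * Bp + τ ^ 2 * Bq := by gcongr
      _ = (‖lam‖ * E + (Bp * (A + 1) ^ 2 + Bq)) * τ ^ 2 := by ring
      _ ≤ (‖lam‖ * E + E * (‖lam‖ ^ 2 - ‖lam‖)) * τ ^ 2 := by gcongr
      _ = E * (‖lam‖ * τ) ^ 2 := by ring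

theorem exists_norm_eval_le (h : IsCurveOrbit lam p q k G) :
    ∃ c M : ℝ, 0 < c ∧ c ≤ 1 ∧ 1 ≤ M ∧ ∀ j, k ≤ j → ∀ t : ℂ, ‖t‖ * ‖lam‖ ^ j ≤ c →
      ‖(G j).eval t‖ ≤ M * (‖t‖ * ‖lam‖ ^ j) ∧
      ‖(G j).eval t - (G j).coeff 1 * t‖ ≤ M * (‖t‖ * ‖lam‖ ^ j) ^ 2 := by
  obtain ⟨A, hA0, hA⟩ := h.exists_norm_coeff_one_le
  obtain ⟨E, hE1, hE⟩ := h.exists_norm_eval_sub_linear_le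
  have hE0 : 0 < E := by linarith
  refine ⟨E⁻¹, A + E, by positivity, inv_le_one_of_one_le₀ hE1, by linarith, fun j hj t ht => ?_⟩
  have h1 : E * (‖t‖ * ‖lam‖ ^ j) ≤ 1 := by
    calc _ ≤ E * E⁻¹ := by gcongr
      _ = 1 := mul_inv_cancel₀ hE0.ne'
  have h2 := hE j hj t h1
  set τ := ‖t‖ * ‖lam‖ ^ j with hτ
  have hτ0 : 0 ≤ τ := by positivity
  have hat : ‖(G j).coeff 1 * t‖ ≤ A * τ := by
    rw [norm_mul]
    calc _ ≤ (A * ‖lam‖ ^ j) * ‖t‖ := by gcongr; exact hA j hj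
      _ = A * τ := by rw [hτ]; ring
  constructor
  · calc ‖(G j).eval t‖ = ‖((G j).eval t - (G j).coeff 1 * t) + (G j).coeff 1 * t‖ := by ring_nf
      _ ≤ E * τ ^ 2 + A * τ := (norm_add_le _ _).trans (by gcongr)
      _ ≤ (A + E) * τ := by nlinarith
  · exact h2.trans (by gcongr; linarith)

/-- The part of order at least three of `G j` at the parameter `t`. -/
noncomputable def cubicRest (G : ℕ → Polynomial ℂ) (j : ℕ) (t : ℂ) : ℂ :=
  (G j).eval t - (G j).coeff 1 * t - (G j).coeff 2 * t ^ 2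

theorem cubicRest_succ (h : IsCurveOrbit lam p q k G) {j : ℕ} (hj : k ≤ j) (t : ℂ) :
    cubicRest G (j + 1) t = lam * cubicRest G j t
      + p.coeff 2 * ((G j).eval t ^ 2 - ((G j).coeff 1 * t) ^ 2)
      + (G j).eval t ^ 3 * p.divX.divX.divX.eval ((G j).eval t)
      + (t * (lam ^ j)⁻¹) ^ 3 * q.divX.divX.divX.eval (t * (lam ^ j)⁻¹) := by
  unfold cubicRest
  rw [h.eval_succ, h.coeff_one_succ hj, h.coeff_two_succ hj, p.eval_eq_jet_two h.p_zero,
    q.eval_eq_jet_two h.q_zero, h.p_one]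
  generalize q.divX.divX.divX.eval (t * (lam ^ j)⁻¹) = Q
  generalize p.divX.divX.divX.eval ((G j).eval t) = P
  ring

theorem exists_norm_cubicRest_le (h : IsCurveOrbit lam p q k G) {j : ℕ} (hj : k ≤ j) :
    ∃ C : ℝ, 1 ≤ C ∧ ∀ t : ℂ, ‖t‖ ≤ 1 → ‖cubicRest G j t‖ ≤ C * ‖t‖ ^ 3 := by
  obtain ⟨C, hC1, hC⟩ := (G j).divX.divX.divX.exists_norm_eval_le 1
  refine ⟨C, hC1, fun t ht => ?_⟩
  have : cubicRest G j t = t ^ 3 * (G j).divX.divX.divX.eval t := by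
    unfold cubicRest
    rw [(G j).eval_eq_jet_two (h.coeff_zero hj)]; ring
  rw [this, norm_mul, norm_pow, mul_comm]
  gcongr
  exact hC t ht

/-- The scale `‖t‖ * ‖lam‖ ^ j` is the natural size of `G j t`; its invariance puts both compared
points under the same bounds. -/
theorem norm_div_mul_pow_succ (h : IsCurveOrbit lam p q k G) (t : ℂ) (j : ℕ) :
    ‖t / lam‖ * ‖lam‖ ^ (j + 1) = ‖t‖ * ‖lam‖ ^ j := by
  have : ‖lam‖ ≠ 0 := by linarith [h.one_lt]
  rw [norm_div, pow_succ]
  field_simp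

/-- The expansion by `lam` cancels the rescaling of `t`, leaving only the forcing by `q`, of order
`‖t‖ / ‖lam‖ ^ j`. -/
theorem coeff_one_succ_mul_sub (h : IsCurveOrbit lam p q k G) {j : ℕ} (hj : k ≤ j) (t : ℂ) :
    (G (j + 1)).coeff 1 * (t / lam) - (G j).coeff 1 * t = q.coeff 1 * (t * (lam ^ j)⁻¹) / lam := by
  have : lam ≠ 0 := norm_pos_iff.mp (by linarith [h.one_lt])
  rw [h.coeff_one_succ hj]
  field_simp
  ring

/-- One step of the recursion for the cubic part of `G (j + 1) (t / lam) - G j t`. -/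
theorem exists_norm_cubicRest_sub_succ_le (h : IsCurveOrbit lam p q k G) {B : ℝ} (hB0 : 0 ≤ B)
    (hB : ∀ j, k ≤ j → ‖(G (j + 1)).coeff 2 / lam ^ 2 - (G j).coeff 2‖ ≤ B) :
    ∃ c C : ℝ, 0 < c ∧ c ≤ 1 ∧ 1 ≤ C ∧ ∀ j, k ≤ j → ∀ t : ℂ, ‖t‖ * ‖lam‖ ^ j ≤ c →
      ‖(G j).eval t‖ ≤ C * (‖t‖ * ‖lam‖ ^ j) ∧
      ‖(G (j + 1)).eval (t / lam) - (G j).eval t‖ ≤ C * (‖t‖ / ‖lam‖ ^ j + ‖t‖ ^ 2)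
        + ‖cubicRest G (j + 1) (t / lam) - cubicRest G j t‖ ∧
      ‖cubicRest G (j + 2) (t / lam) - cubicRest G (j + 1) t‖ ≤
        ‖lam‖ * ‖cubicRest G (j + 1) (t / lam) - cubicRest G j t‖
        + C * (‖t‖ * ‖lam‖ ^ j * ‖cubicRest G (j + 1) (t / lam) - cubicRest G j t‖
          + ‖t‖ ^ 3 * ‖lam‖ ^ j) := by
  have hL := h.one_lt
  have hlam0 : lam ≠ 0 := norm_pos_iff.mp (by linarith)
  obtain ⟨c, M, hc0, hc1, hM1, hM⟩ := h.exists_norm_eval_le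
  obtain ⟨S, hS1, hS⟩ := exists_norm_cubic_sub_le p.divX.divX.divX M
  obtain ⟨Q, hQ1, hQ⟩ := exists_norm_cubic_sub_le q.divX.divX.divX 1
  set K := ‖q.coeff 1‖ with hK
  set C := M + K + B + ‖p.coeff 2‖ * (2 * B * M + 2 * K * M + 2 * M) + S * M ^ 2 * (K + B + 1)
    + 2 * Q with hC
  have hp2 : 0 ≤ ‖p.coeff 2‖ * (2 * B * M + 2 * K * M + 2 * M) := by positivity
  have hS2 : 0 ≤ S * M ^ 2 * (K + B + 1) := by positivity
  have hK0 : 0 ≤ K := norm_nonneg _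
  refine ⟨c, C, hc0, hc1, by linarith, fun j hj t ht => ?_⟩
  have hsj : 1 ≤ ‖lam‖ ^ j := one_le_pow₀ hL.le
  obtain ⟨hx, hxl⟩ := hM j hj t ht
  obtain ⟨hy, hyl⟩ := hM (j + 1) (by omega) (t / lam) (by rwa [h.norm_div_mul_pow_succ])
  have hlin := h.coeff_one_succ_mul_sub hj t
  have hrx := h.cubicRest_succ hj t
  have hry := h.cubicRest_succ (j := j + 1) (by omega) (t / lam)
  rw [h.norm_div_mul_pow_succ] at hy hyl
  have hmt := hB j hj
  have hrd : cubicRest G (j + 1) (t / lam) - cubicRest G j t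
      = ((G (j + 1)).eval (t / lam) - (G j).eval t)
        - ((G (j + 1)).coeff 1 * (t / lam) - (G j).coeff 1 * t)
        - ((G (j + 1)).coeff 2 / lam ^ 2 - (G j).coeff 2) * t ^ 2 := by
    unfold cubicRest
    field_simp
    ring
  set r := cubicRest G (j + 1) (t / lam) - cubicRest G j t with hr
  set x := (G j).eval t
  set y := (G (j + 1)).eval (t / lam)
  set xl := (G j).coeff 1 * t
  set yl := (G (j + 1)).coeff 1 * (t / lam)
  set m := (G (j + 1)).coeff 2 / lam ^ 2 - (G j).coeff 2
  set u := t * (lam ^ j)⁻¹ with hu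
  set v := t / lam * (lam ^ (j + 1))⁻¹ with hv
  set a := ‖t‖ with ha
  set s := ‖lam‖ ^ j with hs
  have ha0 : 0 ≤ a := norm_nonneg _
  have hs0 : 0 < s := by linarith
  have hτ0 : 0 ≤ a * s := by positivity
  have hτ1 : a * s ≤ 1 := ht.trans hc1
  have hun : ‖u‖ = a / s := by rw [hu, norm_mul, norm_inv, norm_pow, div_eq_mul_inv]
  have hinv : ‖lam‖⁻¹ ≤ 1 := inv_le_one_of_one_le₀ hL.le
  have hvn : ‖v‖ ≤ a / s := by
    have : v = u * (lam⁻¹ * lam⁻¹) := by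
      rw [hv, hu, pow_succ]; field_simp
    rw [this, norm_mul u, hun, norm_mul, norm_inv]
    exact mul_le_of_le_one_right (by positivity) (mul_le_one₀ hinv (by positivity) hinv)
  have hLn : ‖yl - xl‖ ≤ K * (a / s) := by
    rw [hlin, norm_div, norm_mul, hun]
    exact div_le_self (by positivity) hL.le
  have hmn : ‖m * t ^ 2‖ ≤ B * a ^ 2 := by
    rw [norm_mul, norm_pow]
    gcongr
  have hdL : ‖(y - x) - (yl - xl)‖ ≤ B * a ^ 2 + ‖r‖ := by
    have : (y - x) - (yl - xl) = m * t ^ 2 + r := by rw [hrd]; ring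
    rw [this]
    exact (norm_add_le _ _).trans (by gcongr)
  have hd : ‖y - x‖ ≤ K * (a / s) + B * a ^ 2 + ‖r‖ := by
    have : y - x = (yl - xl) + ((y - x) - (yl - xl)) := by ring
    rw [this]
    exact (norm_add_le _ _).trans (by linarith)
  have hr0 : 0 ≤ ‖r‖ := norm_nonneg _
  refine ⟨hx.trans (by gcongr; linarith), hd.trans ?_, ?_⟩
  · have h1 : K * (a / s) ≤ C * (a / s) := by gcongr; linarith
    have h2 : B * a ^ 2 ≤ C * a ^ 2 := by gcongr; linarith
    linarith
  -- The quadratic term of `p` is regrouped so that each product gains a factor: `(y - x) - (yl -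
  -- xl)` has no linear part, and `x - xl`, `y - yl` are quadratic.
  have e : cubicRest G (j + 2) (t / lam) - cubicRest G (j + 1) t
      = lam * r + p.coeff 2 * (((y - x) - (yl - xl)) * (x + y)
          + (yl - xl) * ((x - xl) + (y - yl)))
        + (y ^ 3 * p.divX.divX.divX.eval y - x ^ 3 * p.divX.divX.divX.eval x)
        + (v ^ 3 * q.divX.divX.divX.eval v - u ^ 3 * q.divX.divX.divX.eval u) := by
    rw [hry, hrx, hr]; ring
  have hxy : ‖x + y‖ ≤ 2 * M * (a * s) := (norm_add_le _ _).trans (by linarith)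
  have hxyl : ‖(x - xl) + (y - yl)‖ ≤ 2 * M * (a * s) ^ 2 := (norm_add_le _ _).trans (by linarith)
  have hs3 := hS x y (M * (a * s)) hx hy (mul_le_of_le_one_right (by linarith) hτ1)
  have has : a / s ≤ 1 := by
    rw [div_le_one hs0]; nlinarith
  have hq3 := hQ u v (a / s) hun.le hvn has
  have hvu : ‖v - u‖ ≤ 2 * (a / s) := (norm_sub_le _ _).trans (by linarith)
  have has' : (a / s) ^ 3 ≤ a ^ 3 * s := by
    have : a / s ≤ a := div_le_self ha0 hsj
    calc (a / s) ^ 3 ≤ a ^ 3 := by gcongr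
      _ ≤ a ^ 3 * s := le_mul_of_one_le_right (by positivity) hsj
  calc _ ≤ ‖lam‖ * ‖r‖ + ‖p.coeff 2‖ * (‖(y - x) - (yl - xl)‖ * ‖x + y‖
          + ‖yl - xl‖ * ‖(x - xl) + (y - yl)‖)
        + ‖y ^ 3 * p.divX.divX.divX.eval y - x ^ 3 * p.divX.divX.divX.eval x‖
        + ‖v ^ 3 * q.divX.divX.divX.eval v - u ^ 3 * q.divX.divX.divX.eval u‖ := by
        rw [e]
        refine (norm_add_le _ _).trans ?_
        gcongr
        refine norm_add₃_le.trans ?_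
        rw [norm_mul, norm_mul]
        gcongr
        refine (norm_add_le _ _).trans_eq ?_
        rw [norm_mul, norm_mul]
    _ ≤ ‖lam‖ * ‖r‖ + ‖p.coeff 2‖ * ((B * a ^ 2 + ‖r‖) * (2 * M * (a * s))
          + (K * (a / s)) * (2 * M * (a * s) ^ 2))
        + S * (M * (a * s)) ^ 2 * (K * (a / s) + B * a ^ 2 + ‖r‖)
        + Q * (a / s) ^ 2 * (2 * (a / s)) := by
        gcongr
        · exact hs3.trans (by gcongr)
        · exact hq3.trans (by gcongr)
    _ = ‖lam‖ * ‖r‖ + ‖p.coeff 2‖ * ((2 * B * M + 2 * K * M) * (a ^ 3 * s)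
          + 2 * M * (a * s * ‖r‖))
        + S * M ^ 2 * (K * (a ^ 3 * s) + B * (a ^ 3 * s) * (a * s) + (a * s * ‖r‖) * (a * s))
        + 2 * Q * (a / s) ^ 3 := by
        field_simp
        ring
    _ ≤ ‖lam‖ * ‖r‖ + ‖p.coeff 2‖ * ((2 * B * M + 2 * K * M) * (a ^ 3 * s)
          + 2 * M * (a * s * ‖r‖))
        + S * M ^ 2 * (K * (a ^ 3 * s) + B * (a ^ 3 * s) * 1 + (a * s * ‖r‖) * 1)
        + 2 * Q * (a ^ 3 * s) := by gcongr
    _ ≤ ‖lam‖ * ‖r‖ + C * (a * s * ‖r‖ + a ^ 3 * s) := by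
        have hX : 0 ≤ a * s * ‖r‖ := by positivity
        have hY : 0 ≤ a ^ 3 * s := by positivity
        generalize a * s * ‖r‖ = Xr at *
        generalize a ^ 3 * s = Y at *
        have hpn : 0 ≤ ‖p.coeff 2‖ := norm_nonneg _
        have e1 : C * (Xr + Y) - (‖p.coeff 2‖ * ((2 * B * M + 2 * K * M) * Y + 2 * M * Xr)
          + S * M ^ 2 * (K * Y + B * Y * 1 + Xr * 1) + 2 * Q * Y)
          = (M + K + B) * (Xr + Y) + ‖p.coeff 2‖ * ((2 * B * M + 2 * K * M) * Xr + 2 * M * Y)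
            + S * M ^ 2 * ((K + B) * Xr + Y) + 2 * Q * Xr := by
          rw [hC]; ring
        have e2 : 0 ≤ (M + K + B) * (Xr + Y)
            + ‖p.coeff 2‖ * ((2 * B * M + 2 * K * M) * Xr + 2 * M * Y)
            + S * M ^ 2 * ((K + B) * Xr + Y) + 2 * Q * Xr := by positivity
        linarith

/-- If the quadratic coefficients of `G j` have no resonant part, then `G (j + 1) (t / lam)` and
`G j t` agree up to a cubic error whose growth rate exceeds `‖lam‖` as little as desired. -/
theorem exists_norm_eval_succ_sub_le (h : IsCurveOrbit lam p q k G) {B : ℝ}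
    (hB : ∀ j, k ≤ j → ‖(G (j + 1)).coeff 2 / lam ^ 2 - (G j).coeff 2‖ ≤ B)
    {mu : ℝ} (hmu : ‖lam‖ < mu) :
    ∃ c C : ℝ, 0 < c ∧ 1 ≤ C ∧ ∀ j, k ≤ j → ∀ t : ℂ, ‖t‖ * ‖lam‖ ^ j ≤ c →
      ‖(G j).eval t‖ ≤ C * (‖t‖ * ‖lam‖ ^ j) ∧
      ‖(G (j + 1)).eval (t / lam) - (G j).eval t‖
        ≤ C * (‖t‖ / ‖lam‖ ^ j + ‖t‖ ^ 2 + mu ^ j * ‖t‖ ^ 3) := by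
  have hL := h.one_lt
  obtain ⟨c, C, hc0, hc1, hC1, hC⟩ :=
    h.exists_norm_cubicRest_sub_succ_le ((norm_nonneg _).trans (hB k le_rfl)) hB
  obtain ⟨C0, hC01, hC0⟩ := h.exists_norm_cubicRest_le (j := k) le_rfl
  obtain ⟨C1, hC11, hC1'⟩ := h.exists_norm_cubicRest_le (j := k + 1) (by omega)
  -- The gap between `mu` and `‖lam‖` is split in two. One half pays for the perturbation `C * (‖t‖
  -- * ‖lam‖ ^ j) * r`, by smallness of `t`; the other pays for the source term, by `C ≤ K * d`.
  set d := (mu - ‖lam‖) / 2 with hd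
  have hd0 : 0 < d := by rw [hd]; linarith
  set K := max (C0 + C1) (C / d) with hK
  have hKd : C ≤ K * d := by
    rw [← div_le_iff₀ hd0]; exact le_max_right _ _
  have hK1 : C0 + C1 ≤ K := le_max_left _ _
  have key : ∀ j, k ≤ j → ∀ t : ℂ, ‖t‖ * ‖lam‖ ^ j ≤ min c (d / C) →
      ‖cubicRest G (j + 1) (t / lam) - cubicRest G j t‖ ≤ K * (mu ^ j * ‖t‖ ^ 3) := by
    intro j hj
    induction j, hj using Nat.le_induction with
    | base =>
      intro t ht
      have ht1 : ‖t‖ ≤ 1 := by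
        have : ‖t‖ ≤ ‖t‖ * ‖lam‖ ^ k :=
          le_mul_of_one_le_right (norm_nonneg _) (one_le_pow₀ hL.le)
        linarith [min_le_left c (d / C)]
      have htl : ‖t / lam‖ ≤ ‖t‖ := by
        rw [norm_div]; exact div_le_self (norm_nonneg _) hL.le
      have hmuk : 1 ≤ mu ^ k := one_le_pow₀ (by linarith)
      calc _ ≤ C1 * ‖t / lam‖ ^ 3 + C0 * ‖t‖ ^ 3 :=
            (norm_sub_le _ _).trans (add_le_add (hC1' _ (htl.trans ht1)) (hC0 t ht1))
        _ ≤ C1 * ‖t‖ ^ 3 + C0 * ‖t‖ ^ 3 := by gcongr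
        _ = (C0 + C1) * (1 * ‖t‖ ^ 3) := by ring
        _ ≤ K * (mu ^ k * ‖t‖ ^ 3) := by gcongr
    | succ j hj ih =>
      intro t ht
      have ht' : ‖t‖ * ‖lam‖ ^ j ≤ min c (d / C) := by
        refine le_trans ?_ ht
        gcongr
        · exact hL.le
        · omega
      have ih' := ih t ht'
      have hst := (hC j hj t (ht'.trans (min_le_left _ _))).2.2
      have hsm : C * (‖t‖ * ‖lam‖ ^ j) ≤ d := by
        rw [mul_comm, ← le_div_iff₀ (by linarith)]
        exact ht'.trans (min_le_right _ _)
      set r := ‖cubicRest G (j + 1) (t / lam) - cubicRest G j t‖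
      have hr0 : 0 ≤ r := norm_nonneg _
      have hK0 : 0 ≤ K := by linarith
      have hlm : ‖lam‖ ^ j ≤ mu ^ j := by gcongr
      calc _ ≤ ‖lam‖ * r + C * (‖t‖ * ‖lam‖ ^ j * r + ‖t‖ ^ 3 * ‖lam‖ ^ j) := hst
        _ = ‖lam‖ * r + C * (‖t‖ * ‖lam‖ ^ j) * r + C * (‖t‖ ^ 3 * ‖lam‖ ^ j) := by ring
        _ ≤ ‖lam‖ * (K * (mu ^ j * ‖t‖ ^ 3)) + d * (K * (mu ^ j * ‖t‖ ^ 3))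
            + K * d * (‖t‖ ^ 3 * mu ^ j) := by gcongr
        _ = K * (mu ^ (j + 1) * ‖t‖ ^ 3) := by rw [hd, pow_succ]; ring
  refine ⟨min c (d / C), C + K, lt_min hc0 (by positivity), by linarith, fun j hj t ht => ?_⟩
  obtain ⟨h1, h2, -⟩ := hC j hj t (ht.trans (min_le_left _ _))
  have h3 := key j hj t ht
  have hK0 : 0 ≤ K := by linarith
  have hmu0 : 0 ≤ mu := by linarith [norm_nonneg lam]
  refine ⟨h1.trans (by gcongr; linarith), h2.trans ?_⟩
  have e1 : 0 ≤ K * (‖t‖ / ‖lam‖ ^ j + ‖t‖ ^ 2) := by positivity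
  have e2 : 0 ≤ C * (mu ^ j * ‖t‖ ^ 3) := by positivity
  linarith

end IsCurveOrbit

/-! ### Orbits in the moving fibres. -/

/-- The `z`-coordinate of the `j`-th iterate of `(t, z)` under the skew-product. -/
noncomputable def fiberOrbit (lam : ℂ) (p q : Polynomial ℂ) (t z : ℂ) (j : ℕ) : ℂ :=
  ((skewProduct lam p q)^[j] (t, z)).2

section fiberOrbit

variable {lam : ℂ} {p q : Polynomial ℂ}

theorem skewProduct_iterate_eq (j : ℕ) (P : ℂ × ℂ) :
    (skewProduct lam p q)^[j] P = (P.1 / lam ^ j, fiberOrbit lam p q P.1 P.2 j) :=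
  Prod.ext (skewProduct_iterate_fst lam p q j P) rfl

@[simp] theorem fiberOrbit_zero (t z : ℂ) : fiberOrbit lam p q t z 0 = z := rfl

theorem fiberOrbit_succ (t z : ℂ) (j : ℕ) :
    fiberOrbit lam p q t z (j + 1)
      = p.eval (fiberOrbit lam p q t z j) + q.eval (t / lam ^ j) := by
  have h := skewProduct_iterate_eq (lam := lam) (p := p) (q := q) j (t, z)
  unfold fiberOrbit
  rw [Function.iterate_succ_apply', h]
  rfl

theorem fiberOrbit_add (t z : ℂ) (i j : ℕ) :
    fiberOrbit lam p q t z (i + j)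
      = fiberOrbit lam p q (t / lam ^ i) (fiberOrbit lam p q t z i) j := by
  have h := skewProduct_iterate_eq (lam := lam) (p := p) (q := q) i (t, z)
  have h2 := Function.iterate_add_apply (skewProduct lam p q) j i (t, z)
  rw [h] at h2
  rw [add_comm]
  exact congrArg Prod.snd h2

theorem phi_eq_fiberOrbit (x₀ w : ℂ) (n j : ℕ) :
    phi lam p q x₀ n j w = fiberOrbit lam p q (w / lam ^ n) x₀ j := rfl

theorem eval_phiPoly_zero (x₀ t : ℂ) (j : ℕ) :
    (phiPoly lam p q x₀ 0 j).eval t = fiberOrbit lam p q t x₀ j := by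
  rw [phiPoly_eval, phi_eq_fiberOrbit, pow_zero, div_one]

/-- Two orbits in the same fibres separate at most by the Lipschitz constant at each step. -/
theorem norm_fiberOrbit_sub_le {κ ρ ρ' : ℝ} (hκ : 1 ≤ κ)
    (hLip : ∀ x y : ℂ, ‖x‖ ≤ ρ' → ‖y‖ ≤ ρ' → ‖p.eval y - p.eval x‖ ≤ κ * ‖y - x‖)
    {t z z' : ℂ} {i m : ℕ} (hz : ∀ j, i ≤ j → j < i + m → ‖fiberOrbit lam p q t z j‖ ≤ ρ) {b : ℝ}
    (hb : ‖fiberOrbit lam p q t z' i - fiberOrbit lam p q t z i‖ ≤ b)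
    (hbm : κ ^ m * b ≤ ρ' - ρ) :
    ∀ j, i ≤ j → j ≤ i + m →
      ‖fiberOrbit lam p q t z' j - fiberOrbit lam p q t z j‖ ≤ κ ^ m * b := by
  have hb0 : 0 ≤ b := (norm_nonneg _).trans hb
  have key : ∀ l, l ≤ m →
      ‖fiberOrbit lam p q t z' (i + l) - fiberOrbit lam p q t z (i + l)‖ ≤ κ ^ l * b := by
    intro l
    induction l with
    | zero => intro _; simpa using hb
    | succ l ih =>
      intro hl
      have h1 := ih (by omega)
      have h2 := hz (i + l) (by omega) (by omega)
      have hlm : κ ^ l * b ≤ κ ^ m * b := by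
        gcongr
        omega
      have h3 : ‖fiberOrbit lam p q t z' (i + l)‖ ≤ ρ' := by
        calc _ = ‖(fiberOrbit lam p q t z' (i + l) - fiberOrbit lam p q t z (i + l))
              + fiberOrbit lam p q t z (i + l)‖ := by ring_nf
          _ ≤ κ ^ l * b + ρ := (norm_add_le _ _).trans (add_le_add h1 h2)
          _ ≤ ρ' := by linarith
      have hmb : 0 ≤ κ ^ m * b := by positivity
      rw [← add_assoc, fiberOrbit_succ, fiberOrbit_succ, add_sub_add_right_eq_sub, pow_succ']
      calc _ ≤ κ * ‖fiberOrbit lam p q t z' (i + l) - fiberOrbit lam p q t z (i + l)‖ :=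
            hLip _ _ (h2.trans (by linarith)) h3
        _ ≤ κ * (κ ^ l * b) := by gcongr
        _ = _ := by ring
  intro j hij hj
  obtain ⟨l, rfl⟩ := Nat.exists_eq_add_of_le hij
  have hl : l ≤ m := by omega
  refine (key l hl).trans ?_
  gcongr

end fiberOrbit

/-! ### The orbit of the critical point and its return. -/

theorem isCurveOrbit_phiPoly {lam : ℂ} (hlam : 1 < ‖lam‖) {p q : Polynomial ℂ}
    (hp0 : p.eval 0 = 0) (hp1 : p.derivative.eval 0 = lam) (hq0 : q.eval 0 = 0)
    {x₀ : ℂ} {k : ℕ} (hk : (fun z : ℂ => p.eval z)^[k] x₀ = 0) :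
    IsCurveOrbit lam p q k (fun j => phiPoly lam p q x₀ 0 j) where
  one_lt := hlam
  p_zero := by rw [Polynomial.coeff_zero_eq_eval_zero, hp0]
  p_one := by
    rw [← hp1, ← Polynomial.coeff_zero_eq_eval_zero, Polynomial.coeff_derivative]
    simp
  q_zero := by rw [Polynomial.coeff_zero_eq_eval_zero, hq0]
  succ j := by simp [phiPoly]
  base := by
    rw [Polynomial.coeff_zero_eq_eval_zero]
    have : ∀ j, (phiPoly lam p q x₀ 0 j).eval 0 = (fun z : ℂ => p.eval z)^[j] x₀ := by
      intro j
      induction j with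
      | zero => simp [phiPoly]
      | succ j ih =>
        rw [Function.iterate_succ_apply', ← ih]
        simp [phiPoly, hq0]
    rw [this, hk]

/-- Division by `lam ^ 2` cancels the `X₂` term exactly. The `X₁` term would leave `X₁ * lam ^ j *
(lam⁻¹ - 1)`, the only unbounded contribution; this is where degeneracy enters. -/
theorem IsDegenerateResonant.exists_norm_coeff_two_le {lam : ℂ} (hlam : 1 < ‖lam‖)
    {p q : Polynomial ℂ} {x₀ : ℂ} {k : ℕ} (h : IsDegenerateResonant lam p q x₀ k) :
    ∃ B : ℝ, ∀ j, k ≤ j → ‖(phiPoly lam p q x₀ 0 (j + 1)).coeff 2 / lam ^ 2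
      - (phiPoly lam p q x₀ 0 j).coeff 2‖ ≤ B := by
  obtain ⟨X₂, X₁, X₀, Y₁, Y₂, hX, rfl⟩ := h
  have hlam0 : lam ≠ 0 := norm_pos_iff.mp (by linarith)
  have hform : ∀ j, k ≤ j → (phiPoly lam p q x₀ 0 j).coeff 2
      = X₂ * (lam ^ j) ^ 2 + X₀ + Y₁ * (lam ^ j)⁻¹ + Y₂ * ((lam ^ j)⁻¹) ^ 2 := by
    intro j hj
    rw [hX 0 j hj]
    have e1 : lam ^ (2 * (j : ℤ)) = (lam ^ j) ^ 2 := by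
      rw [mul_comm, zpow_mul]; norm_cast
    have e2 : lam ^ (-(2 * (j : ℤ))) = ((lam ^ j)⁻¹) ^ 2 := by
      rw [zpow_neg, e1, inv_pow]
    simp [e1, e2]
  refine ⟨2 * ‖X₀‖ + 2 * ‖Y₁‖ + 2 * ‖Y₂‖, fun j hj => ?_⟩
  have e : (phiPoly lam p q x₀ 0 (j + 1)).coeff 2 / lam ^ 2 - (phiPoly lam p q x₀ 0 j).coeff 2
      = X₀ * ((lam⁻¹) ^ 2 - 1) + Y₁ * ((lam⁻¹) ^ j * ((lam⁻¹) ^ 3 - 1))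
        + Y₂ * ((lam⁻¹) ^ (2 * j) * ((lam⁻¹) ^ 4 - 1)) := by
    rw [hform j hj, hform (j + 1) (by omega)]
    simp only [inv_pow]
    field_simp
    ring
  have hinv : ‖lam⁻¹‖ ≤ 1 := by
    rw [norm_inv]; exact inv_le_one_of_one_le₀ hlam.le
  have hpow : ∀ m : ℕ, ‖(lam⁻¹) ^ m‖ ≤ 1 := fun m => by
    rw [norm_pow]; exact pow_le_one₀ (norm_nonneg _) hinv
  have hsub : ∀ m : ℕ, ‖(lam⁻¹) ^ m - 1‖ ≤ 2 := fun m => by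
    refine (norm_sub_le _ _).trans ?_
    rw [norm_one]; linarith [hpow m]
  have hmul : ∀ l m : ℕ, ‖(lam⁻¹) ^ l * ((lam⁻¹) ^ m - 1)‖ ≤ 2 := fun l m => by
    rw [norm_mul]
    calc _ ≤ 1 * 2 := mul_le_mul (hpow l) (hsub m) (norm_nonneg _) zero_le_one
      _ = 2 := by norm_num
  rw [e]
  refine norm_add₃_le.trans ?_
  rw [norm_mul, norm_mul Y₁, norm_mul Y₂, mul_comm 2 ‖X₀‖, mul_comm 2 ‖Y₁‖, mul_comm 2 ‖Y₂‖]
  gcongr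
  · exact hsub 2
  · exact hmul j 3
  · exact hmul (2 * j) 4

/-- The orbits of `(w₀ / lam ^ n, x₀)` up to time `n`: they are bounded, close to `0` for most of
the time, and return to `x₀` exponentially fast in `n`. -/
theorem exists_fiberOrbit_estimates {lam : ℂ} (hlam : 1 < ‖lam‖) {p q : Polynomial ℂ}
    (hp0 : p.eval 0 = 0) (hp1 : p.derivative.eval 0 = lam) (hq0 : q.eval 0 = 0)
    {x₀ : ℂ} {k : ℕ} (hk : (fun z : ℂ => p.eval z)^[k] x₀ = 0)
    {B : ℝ} (hB : ∀ j, k ≤ j → ‖(phiPoly lam p q x₀ 0 (j + 1)).coeff 2 / lam ^ 2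
      - (phiPoly lam p q x₀ 0 j).coeff 2‖ ≤ B)
    {w₀ : ℂ} (hw₀ : Tendsto (fun n : ℕ => phi lam p q x₀ n n w₀) atTop (𝓝 x₀))
    {mu : ℝ} (hmu : ‖lam‖ < mu) (hmu' : mu < ‖lam‖ ^ 3) {r : ℝ} (hr : 0 < r) :
    ∃ (M : ℕ) (C R : ℝ), 0 ≤ C ∧ ∀ n, k + M ≤ n →
      (∀ j, j ≤ n → ‖fiberOrbit lam p q (w₀ / lam ^ n) x₀ j‖ ≤ R) ∧
      (∀ j, k ≤ j → j + M ≤ n → ‖fiberOrbit lam p q (w₀ / lam ^ n) x₀ j‖ ≤ r) ∧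
      ‖fiberOrbit lam p q (w₀ / lam ^ n) x₀ n - x₀‖ ≤ C * (mu / ‖lam‖ ^ 3) ^ n := by
  have hlam0 : lam ≠ 0 := norm_pos_iff.mp (by linarith)
  set s := ‖lam‖ with hs
  have hs0 : 0 < s := by linarith
  obtain ⟨c, K, hc0, hK1, hK⟩ := (isCurveOrbit_phiPoly hlam hp0 hp1 hq0 hk)
    |>.exists_norm_eval_succ_sub_le hB hmu
  simp only [eval_phiPoly_zero, ← hs] at hK
  have hK0 : 0 < K := by linarith
  set th := mu / s ^ 3 with hth
  have hth0 : 0 < th := by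
    have : 0 < mu := by linarith
    positivity
  have hth1 : th < 1 := by rw [hth, div_lt_one (by positivity)]; exact hmu'
  have hsth : ∀ m : ℕ, (s ^ (2 * m))⁻¹ ≤ th ^ m := by
    intro m
    have : (s ^ 2)⁻¹ ≤ th := by
      rw [hth, le_div_iff₀ (by positivity)]
      have : (s ^ 2)⁻¹ * s ^ 3 = s := by field_simp
      rw [this]; exact hmu.le
    calc (s ^ (2 * m))⁻¹ = ((s ^ 2)⁻¹) ^ m := by rw [pow_mul, inv_pow]
      _ ≤ th ^ m := by gcongr
  -- The local estimates hold until the last `M` steps; it matters that `M` does not depend on `n`.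
  obtain ⟨M, hM⟩ : ∃ M : ℕ, ‖w₀‖ / s ^ M < min c (r / K) := by
    have h1 : Tendsto (fun m : ℕ => ‖w₀‖ / s ^ m) atTop (𝓝 0) :=
      tendsto_const_nhds.div_atTop (tendsto_pow_atTop_atTop_of_one_lt hlam)
    exact (h1.eventually_lt_const (lt_min hc0 (by positivity))).exists
  have hnt : ∀ n : ℕ, ‖w₀ / lam ^ n‖ = ‖w₀‖ / s ^ n := fun n => by rw [norm_div, norm_pow]
  have hsmall : ∀ n j, j + M ≤ n → ‖w₀ / lam ^ n‖ * s ^ j ≤ ‖w₀‖ / s ^ M := by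
    intro n j hj
    rw [hnt, div_mul_eq_mul_div, div_le_div_iff₀ (by positivity) (by positivity), mul_assoc,
      ← pow_add]
    gcongr
    exact hlam.le
  have hnear : ∀ n j, k ≤ j → j + M ≤ n → ‖fiberOrbit lam p q (w₀ / lam ^ n) x₀ j‖ ≤ r := by
    intro n j hj hjn
    have h1 := (hsmall n j hjn).trans hM.le
    calc _ ≤ K * (‖w₀ / lam ^ n‖ * s ^ j) := (hK j hj _ (h1.trans (min_le_left _ _))).1
      _ ≤ K * (r / K) := by gcongr; exact h1.trans (min_le_right _ _)
      _ = r := by field_simp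
  have hdiff0 : ∃ D : ℝ, 0 ≤ D ∧ ∀ m, k ≤ m →
      ‖fiberOrbit lam p q (w₀ / lam ^ (m + 1 + M)) x₀ (m + 1)
        - fiberOrbit lam p q (w₀ / lam ^ (m + M)) x₀ m‖ ≤ D * th ^ m := by
    refine ⟨K * (‖w₀‖ + ‖w₀‖ ^ 2 + ‖w₀‖ ^ 3), by positivity, fun m hm => ?_⟩
    have h1 := (hK m hm (w₀ / lam ^ (m + M))
      (((hsmall _ m le_rfl).trans hM.le).trans (min_le_left _ _))).2
    have e : w₀ / lam ^ (m + M) / lam = w₀ / lam ^ (m + 1 + M) := by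
      rw [div_div, ← pow_succ]; ring_nf
    rw [e, hnt] at h1
    have h2 : ‖w₀‖ / s ^ (m + M) ≤ ‖w₀‖ / s ^ m := by
      gcongr
      · exact hlam.le
      · omega
    have hmu0 : 0 < mu := by linarith
    calc _ ≤ K * (‖w₀‖ / s ^ (m + M) / s ^ m + (‖w₀‖ / s ^ (m + M)) ^ 2
          + mu ^ m * (‖w₀‖ / s ^ (m + M)) ^ 3) := h1
      _ ≤ K * (‖w₀‖ / s ^ m / s ^ m + (‖w₀‖ / s ^ m) ^ 2 + mu ^ m * (‖w₀‖ / s ^ m) ^ 3) := by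
          gcongr
      _ = K * (‖w₀‖ * (s ^ (2 * m))⁻¹ + ‖w₀‖ ^ 2 * (s ^ (2 * m))⁻¹ + ‖w₀‖ ^ 3 * th ^ m) := by
          have e2 : s ^ (2 * m) = (s ^ m) ^ 2 := by rw [← pow_mul, mul_comm]
          have e3 : th ^ m = mu ^ m / (s ^ m) ^ 3 := by
            rw [hth, div_pow, ← pow_mul, ← pow_mul, mul_comm]
          rw [e2, e3]
          field_simp
      _ ≤ K * (‖w₀‖ * th ^ m + ‖w₀‖ ^ 2 * th ^ m + ‖w₀‖ ^ 3 * th ^ m) := by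
          gcongr <;> exact hsth m
      _ = _ := by ring
  obtain ⟨Bq, hBq1, hBq⟩ := q.exists_norm_eval_le ‖w₀‖
  obtain ⟨Lq, hLq1, hLq⟩ := q.exists_norm_eval_sub_le ‖w₀‖
  -- Each step after leaving the neighbourhood of `0` worsens the constants but keeps the rate `th`;
  -- only `i ≤ M` is needed.
  have hlate : ∀ i : ℕ, ∃ R D : ℝ, 0 ≤ R ∧ 0 ≤ D ∧ ∀ m, k ≤ m →
      ‖fiberOrbit lam p q (w₀ / lam ^ (m + M)) x₀ (m + i)‖ ≤ R ∧
      ‖fiberOrbit lam p q (w₀ / lam ^ (m + 1 + M)) x₀ (m + 1 + i)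
        - fiberOrbit lam p q (w₀ / lam ^ (m + M)) x₀ (m + i)‖ ≤ D * th ^ m := by
    intro i
    induction i with
    | zero =>
      obtain ⟨D, hD0, hD⟩ := hdiff0
      exact ⟨r, D, hr.le, hD0, fun m hm => ⟨hnear _ _ hm le_rfl, hD m hm⟩⟩
    | succ i ih =>
      obtain ⟨R, D, hR0, hD0, hRD⟩ := ih
      obtain ⟨Bp, hBp1, hBp⟩ := p.exists_norm_eval_le R
      obtain ⟨Lp, hLp1, hLp⟩ := p.exists_norm_eval_sub_le R
      have hpar : ∀ m : ℕ, ‖w₀ / lam ^ (m + M) / lam ^ (m + i)‖ ≤ ‖w₀‖ * (s ^ (2 * m))⁻¹ := by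
        intro m
        rw [div_div, ← pow_add, hnt, div_eq_mul_inv]
        gcongr
        · exact hlam.le
        · omega
      have hpar' : ∀ m : ℕ, ‖w₀ / lam ^ (m + M) / lam ^ (m + i)‖ ≤ ‖w₀‖ := fun m =>
        (hpar m).trans (mul_le_of_le_one_right (norm_nonneg _)
          (inv_le_one_of_one_le₀ (one_le_pow₀ hlam.le)))
      refine ⟨Bp + Bq, Lp * D + Lq * (2 * ‖w₀‖), by linarith, by positivity, fun m hm => ?_⟩
      obtain ⟨h1, h2⟩ := hRD m hm
      obtain ⟨h1', -⟩ := hRD (m + 1) (by omega)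
      rw [← add_assoc, ← add_assoc, fiberOrbit_succ, fiberOrbit_succ]
      constructor
      · exact (norm_add_le _ _).trans (add_le_add (hBp _ h1) (hBq _ (hpar' m)))
      · have hA := hLp _ _ h1 h1'
        have hQ := hLq _ _ (hpar' m) (hpar' (m + 1))
        have hQ' : ‖w₀ / lam ^ (m + 1 + M) / lam ^ (m + 1 + i)
            - w₀ / lam ^ (m + M) / lam ^ (m + i)‖ ≤ 2 * ‖w₀‖ * th ^ m := by
          have h3 := (hpar (m + 1))
          have h4 : (s ^ (2 * (m + 1)))⁻¹ ≤ (s ^ (2 * m))⁻¹ := by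
            gcongr
            · exact hlam.le
            · omega
          calc _ ≤ ‖w₀‖ * (s ^ (2 * (m + 1)))⁻¹ + ‖w₀‖ * (s ^ (2 * m))⁻¹ :=
                (norm_sub_le _ _).trans (add_le_add h3 (hpar m))
            _ ≤ ‖w₀‖ * th ^ m + ‖w₀‖ * th ^ m := by
                gcongr
                · exact h4.trans (hsth m)
                · exact hsth m
            _ = _ := by ring
        rw [add_sub_add_comm]
        refine (norm_add_le _ _).trans ?_
        calc _ ≤ Lp * (D * th ^ m) + Lq * (2 * ‖w₀‖ * th ^ m) := by
              gcongr
              · exact hA.trans (by gcongr)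
              · exact hQ.trans (by gcongr)
          _ = _ := by ring
  choose Rl Dl hRl0 hDl0 hRDl using hlate
  have hearly : ∀ j : ℕ, ∃ R : ℝ, 0 ≤ R ∧ ∀ n, ‖fiberOrbit lam p q (w₀ / lam ^ n) x₀ j‖ ≤ R := by
    intro j
    obtain ⟨R, hR1, hR⟩ := (phiPoly lam p q x₀ 0 j).exists_norm_eval_le ‖w₀‖
    refine ⟨R, by linarith, fun n => ?_⟩
    rw [← eval_phiPoly_zero]
    refine hR _ ?_
    rw [hnt]
    exact div_le_self (norm_nonneg _) (one_le_pow₀ hlam.le)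
  choose Re hRe0 hRe using hearly
  have hsumE : 0 ≤ ∑ j ∈ Finset.range k, Re j := Finset.sum_nonneg fun j _ => hRe0 j
  have hsumL : 0 ≤ ∑ j ∈ Finset.range (M + 1), Rl j := Finset.sum_nonneg fun j _ => hRl0 j
  -- The tail of the geometric series gives `1 / (1 - th)`; the factor `1 / th ^ M` converts the
  -- exponent `k + m` to `n = k + m + M`.
  refine ⟨M, Dl M / (1 - th) / th ^ M,
    ∑ j ∈ Finset.range k, Re j + r + ∑ j ∈ Finset.range (M + 1), Rl j, ?_, fun n hn => ?_⟩
  · have := hDl0 M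
    have : 0 < 1 - th := by linarith
    positivity
  refine ⟨fun j hj => ?_, fun j => hnear n j, ?_⟩
  · rcases lt_or_ge j k with h | h
    · have := Finset.single_le_sum (f := Re) (fun j _ => hRe0 j) (Finset.mem_range.mpr h)
      linarith [hRe j n]
    · rcases le_or_gt (j + M) n with h' | h'
      · linarith [hnear n j h h']
      · obtain ⟨m, rfl⟩ : ∃ m, n = m + M := ⟨n - M, by omega⟩
        obtain ⟨i, rfl⟩ : ∃ i, j = m + i := ⟨j - m, by omega⟩
        have := Finset.single_le_sum (f := Rl) (fun j _ => hRl0 j)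
          (Finset.mem_range.mpr (show i < M + 1 by omega))
        linarith [(hRDl i m (by omega)).1]
  · obtain ⟨m, rfl⟩ : ∃ m, n = k + m + M := ⟨n - M - k, by omega⟩
    set f : ℕ → ℂ := fun m => fiberOrbit lam p q (w₀ / lam ^ (k + m + M)) x₀ (k + m + M) with hf
    have hlim : Tendsto f atTop (𝓝 x₀) := by
      refine hw₀.comp (f := fun m => k + m + M) ?_
      exact tendsto_atTop_mono (fun m => (by omega : m ≤ k + m + M)) tendsto_id
    have hu : ∀ m, dist (f m) (f (m + 1)) ≤ (Dl M * th ^ k) * th ^ m := by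
      intro m
      rw [dist_comm, dist_eq_norm, mul_assoc, ← pow_add]
      exact (hRDl M (k + m) (by omega)).2
    have := dist_le_of_le_geometric_of_tendsto th (Dl M * th ^ k) hth1 hu hlim m
    rw [dist_eq_norm] at this
    refine this.trans_eq ?_
    rw [pow_add, pow_add]
    field_simp

/-! ### Dynamics of the vertical disks. -/

/-- The radii of the vertical disks decay geometrically, and there is a rate `mu > ‖lam‖` for which
`mu / ‖lam‖ ^ 3` is below the square of their ratio. -/
theorem exists_geometric_radius {s : ℝ} (hs : 1 < s) :
    ∃ a mu : ℝ, 0 < a ∧ a < 1 ∧ a ^ 4 = (s ^ 3)⁻¹ ∧ s < mu ∧ mu / s ^ 3 < a ^ 2 ∧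
      ∀ n : ℕ, s ^ (-(3 * (n : ℝ) / 4)) = a ^ n := by
  have hs0 : 0 < s := by linarith
  have hs3 : s ^ 3 = s ^ (3 : ℝ) := by norm_cast
  -- Any exponent of `mu` strictly between `1` and `3/2` would do; with `5/4` the last comparison is
  -- `-7/4 < -3/2`.
  refine ⟨s ^ (-(3 / 4) : ℝ), s ^ (5 / 4 : ℝ), by positivity,
    Real.rpow_lt_one_of_one_lt_of_neg hs (by norm_num), ?_, ?_, ?_, fun n => ?_⟩
  · rw [hs3, ← Real.rpow_natCast, ← Real.rpow_mul hs0.le, ← Real.rpow_neg hs0.le]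
    norm_num
  · conv_lhs => rw [← Real.rpow_one s]
    exact Real.rpow_lt_rpow_of_exponent_lt hs (by norm_num)
  · rw [hs3, ← Real.rpow_natCast, ← Real.rpow_mul hs0.le, ← Real.rpow_sub hs0]
    exact Real.rpow_lt_rpow_of_exponent_lt hs (by norm_num)
  · rw [← Real.rpow_natCast, ← Real.rpow_mul hs0.le]
    congr 1
    ring

/-- For large `n` the first `n` iterates of `D_n` are bounded and of small diameter, and the
`n`-th one lies in `D_{2n}`. -/
theorem exists_verticalDisk_dynamics {lam : ℂ} (hlam : 1 < ‖lam‖) {p q : Polynomial ℂ}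
    (hp0 : p.eval 0 = 0) (hp1 : p.derivative.eval 0 = lam) (hq0 : q.eval 0 = 0)
    {x₀ : ℂ} (hcrit : 3 ≤ p.derivative.rootMultiplicity x₀)
    {k : ℕ} (hk1 : 1 ≤ k) (hk : (fun z : ℂ => p.eval z)^[k] x₀ = 0)
    {B : ℝ} (hB : ∀ j, k ≤ j → ‖(phiPoly lam p q x₀ 0 (j + 1)).coeff 2 / lam ^ 2
      - (phiPoly lam p q x₀ 0 j).coeff 2‖ ≤ B)
    {w₀ : ℂ} (hw₀ : Tendsto (fun n : ℕ => phi lam p q x₀ n n w₀) atTop (𝓝 x₀)) :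
    ∃ (N : ℕ) (R : ℝ) (d : ℕ → ℝ), 1 ≤ N ∧ Tendsto d atTop (𝓝 0) ∧ ∀ n, N ≤ n → ∀ z : ℂ,
      ‖z - x₀‖ < ‖lam‖ ^ (-(3 * (n : ℝ) / 4)) →
      (∀ j, j ≤ n → ‖fiberOrbit lam p q (w₀ / lam ^ n) z j‖ ≤ R ∧
        ‖fiberOrbit lam p q (w₀ / lam ^ n) z j
          - fiberOrbit lam p q (w₀ / lam ^ n) x₀ j‖ ≤ d n) ∧
      ‖fiberOrbit lam p q (w₀ / lam ^ n) z n - x₀‖ < ‖lam‖ ^ (-(3 * ((2 * n : ℕ) : ℝ) / 4)) := by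
  obtain ⟨a, mu, ha0, ha1, ha4, hmu, hmua, hrad⟩ := exists_geometric_radius hlam
  simp only [hrad]
  set s := ‖lam‖ with hs
  have hs0 : 0 < s := by linarith
  have hmu0 : 0 < mu := by linarith
  obtain ⟨r, hr0, hr⟩ := p.exists_norm_eval_sub_le_near_zero (m := mu) (by rw [hp1]; exact hmu)
  have hmu3 : mu < s ^ 3 := by
    rw [← div_lt_one (by positivity)]
    nlinarith
  obtain ⟨M, C, R, hC0, hMCR⟩ := exists_fiberOrbit_estimates hlam hp0 hp1 hq0 hk hB hw₀ hmu hmu3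
    (half_pos hr0)
  simp only [← hs] at hMCR
  set th := mu / s ^ 3 with hth
  have hth0 : 0 < th := by positivity
  have hth1 : th < 1 := by rw [hth, div_lt_one (by positivity)]; exact hmu3
  obtain ⟨L, hL1, hL⟩ := p.exists_norm_eval_sub_le (R + 1)
  obtain ⟨g, hg⟩ := p.exists_eval_sub_eq_pow_four_mul x₀ hcrit
  obtain ⟨Cg, hCg1, hCg⟩ := g.exists_norm_eval_le (‖x₀‖ + 1)
  -- After the contracting first step come `k - 1` steps towards `0` and at the end `M` steps away
  -- from it, each with constant `L`; the steps near `0` are accounted for by `mu ^ n`.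
  set D := L ^ M * (L ^ (k - 1) * Cg) with hD
  have hthn : Tendsto (fun n : ℕ => D * th ^ n) atTop (𝓝 0) := by
    simpa using (tendsto_pow_atTop_nhds_zero_of_lt_one hth0.le hth1).const_mul D
  have hratio : Tendsto (fun n : ℕ => (D + C) * (th / a ^ 2) ^ n) atTop (𝓝 0) := by
    have : th / a ^ 2 < 1 := by rw [div_lt_one (by positivity)]; exact hmua
    simpa using (tendsto_pow_atTop_nhds_zero_of_lt_one (by positivity) this).const_mul (D + C)
  obtain ⟨N, hN⟩ := eventually_atTop.mp
    ((hthn.eventually_lt_const (lt_min one_pos (half_pos hr0))).and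
      ((hratio.eventually_lt_const one_pos).and (eventually_ge_atTop (k + M))))
  -- The summand `a ^ n` covers time `0`, before the contraction.
  refine ⟨max N 1, R + 1, fun n => a ^ n + D * th ^ n, le_max_right _ _, ?_, fun n hn z hz => ?_⟩
  · simpa using (tendsto_pow_atTop_nhds_zero_of_lt_one ha0.le ha1).add hthn
  obtain ⟨hn1, hn2, hn3⟩ := hN n ((le_max_left _ _).trans hn)
  obtain ⟨hR, hnear, hret⟩ := hMCR n hn3
  set t := w₀ / lam ^ n
  have han : a ^ n ≤ 1 := pow_le_one₀ ha0.le ha1.le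
  have hL0 : 0 < L := by linarith
  have hfirst : ‖fiberOrbit lam p q t z 1 - fiberOrbit lam p q t x₀ 1‖ ≤ Cg * ((s ^ 3)⁻¹) ^ n := by
    rw [fiberOrbit_succ t z 0, fiberOrbit_succ t x₀ 0, add_sub_add_right_eq_sub]
    simp only [fiberOrbit_zero]
    rw [hg, norm_mul, norm_pow, mul_comm, ← ha4, ← pow_mul, mul_comm 4 n, pow_mul]
    gcongr
    refine hCg z ?_
    calc ‖z‖ = ‖x₀ + (z - x₀)‖ := by ring_nf
      _ ≤ ‖x₀‖ + 1 := (norm_add_le _ _).trans (by gcongr; linarith)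
  have hscale : mu ^ n * ((s ^ 3)⁻¹) ^ n = th ^ n := by
    rw [← mul_pow, hth, div_eq_mul_inv]
  set b₁ := Cg * ((s ^ 3)⁻¹) ^ n with hb₁
  have hb₁0 : 0 < b₁ := by positivity
  have hLk : 1 ≤ L ^ (k - 1) := one_le_pow₀ hL1
  have hLM : 1 ≤ L ^ M := one_le_pow₀ hL1
  have hmun : 1 ≤ mu ^ n := one_le_pow₀ (by linarith)
  have hb : D * th ^ n = L ^ M * (mu ^ n * (L ^ (k - 1) * b₁)) := by
    rw [hD, hb₁, ← hscale]; ring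
  have hb2 : mu ^ n * (L ^ (k - 1) * b₁) ≤ D * th ^ n := by
    rw [hb]; exact le_mul_of_one_le_left (by positivity) hLM
  have hb1 : L ^ (k - 1) * b₁ ≤ D * th ^ n :=
    (le_mul_of_one_le_left (by positivity) hmun).trans hb2
  have hD1 : D * th ^ n ≤ 1 := hn1.le.trans (min_le_left _ _)
  have hDr : D * th ^ n ≤ r / 2 := hn1.le.trans (min_le_right _ _)
  have hstage1 := norm_fiberOrbit_sub_le (q := q) (t := t) (z := x₀) (z' := z) (i := 1)
    (m := k - 1) (ρ := R) hL1 hL (fun j _ hj => hR j (by omega)) hfirst (by linarith)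
  obtain ⟨m, hm⟩ : ∃ m, n = k + m + M := ⟨n - M - k, by omega⟩
  have hmm : mu ^ m * (L ^ (k - 1) * b₁) ≤ mu ^ n * (L ^ (k - 1) * b₁) := by
    gcongr
    · linarith
    · omega
  have hstage2 := norm_fiberOrbit_sub_le (q := q) (t := t) (z := x₀) (z' := z) (i := k)
    (m := m) (ρ := r / 2) (κ := mu) (by linarith) hr (fun j h1 h2 => hnear j h1 (by omega))
    (hstage1 k hk1 (by omega)) (by linarith)
  have hstage3 := norm_fiberOrbit_sub_le (q := q) (t := t) (z := x₀) (z' := z) (i := k + m)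
    (m := M) (ρ := R) hL1 hL (fun j _ hj => hR j (by omega))
    ((hstage2 (k + m) (by omega) le_rfl).trans hmm) (by linarith)
  have hall : ∀ j, 1 ≤ j → j ≤ n →
      ‖fiberOrbit lam p q t z j - fiberOrbit lam p q t x₀ j‖ ≤ D * th ^ n := by
    intro j h1 h2
    rcases le_or_gt j k with h | h
    · exact (hstage1 j h1 (by omega)).trans hb1
    rcases le_or_gt j (k + m) with h' | h'
    · exact (hstage2 j h.le h').trans (hmm.trans hb2)
    · exact (hstage3 j h'.le (by omega)).trans hb.ge
  refine ⟨fun j hj => ?_, ?_⟩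
  · have hDn0 : 0 ≤ D * th ^ n := by positivity
    have han0 : 0 ≤ a ^ n := by positivity
    have hu : ‖fiberOrbit lam p q t z j - fiberOrbit lam p q t x₀ j‖ ≤ 1 ∧
        ‖fiberOrbit lam p q t z j - fiberOrbit lam p q t x₀ j‖ ≤ a ^ n + D * th ^ n := by
      rcases Nat.eq_zero_or_pos j with rfl | h
      · simp only [fiberOrbit_zero]
        constructor <;> linarith
      · have := hall j h hj
        constructor <;> linarith
    refine ⟨?_, hu.2⟩
    calc _ = ‖fiberOrbit lam p q t x₀ j
          + (fiberOrbit lam p q t z j - fiberOrbit lam p q t x₀ j)‖ := by ring_nf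
      _ ≤ R + 1 := (norm_add_le _ _).trans (add_le_add (hR j hj) hu.1)
  · have h1 := hall n (by omega) le_rfl
    have h2 : (D + C) * th ^ n < a ^ (2 * n) := by
      rw [div_pow, ← pow_mul, ← mul_div_assoc, div_lt_one (by positivity)] at hn2
      exact hn2
    calc _ = ‖(fiberOrbit lam p q t z n - fiberOrbit lam p q t x₀ n)
          + (fiberOrbit lam p q t x₀ n - x₀)‖ := by ring_nf
      _ ≤ D * th ^ n + C * th ^ n := (norm_add_le _ _).trans (add_le_add h1 hret)
      _ = (D + C) * th ^ n := by ring
      _ < _ := h2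

/-! ### Holomorphic disks and normality. -/

theorem isHolomorphicDisk_verticalDisk {lam : ℂ} (hlam : lam ≠ 0) (w₀ x₀ : ℂ) (n : ℕ) :
    IsHolomorphicDisk (verticalDisk lam w₀ x₀ n) := by
  set e : ℝ := ‖lam‖ ^ (-(3 * (n : ℝ) / 4)) with he
  have he0 : 0 < e := Real.rpow_pos_of_pos (norm_pos_iff.mpr hlam) _
  have hec : (e : ℂ) ≠ 0 := by exact_mod_cast he0.ne'
  set h : ℂ → ℂ × ℂ := fun ζ => (w₀ / lam ^ n, x₀ + e * ζ) with hh
  have hder : ∀ ζ, HasDerivAt h (0, (e : ℂ)) ζ := by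
    intro ζ
    refine (hasDerivAt_const ζ _).prodMk ?_
    simpa using ((hasDerivAt_id ζ).const_mul (e : ℂ)).const_add x₀
  refine ⟨h, fun ζ _ => (hder ζ).differentiableAt.differentiableWithinAt, fun ζ _ => ?_, ?_, ?_⟩
  · rw [(hder ζ).deriv]
    simp [hec]
  · have hemb : IsEmbedding h := by
      refine Topology.IsEmbedding.of_leftInverse (f := fun P : ℂ × ℂ => (P.2 - x₀) / e) ?_ ?_ ?_
      · intro ζ
        simp only [hh]
        field_simp
        ring
      · fun_prop
      · fun_prop
    exact hemb.comp IsEmbedding.subtypeVal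
  · ext ⟨u, z⟩
    simp only [verticalDisk, Set.mem_image, Metric.mem_ball, dist_zero_right, Set.mem_ofPred_eq,
      ← he, hh, Prod.mk.injEq]
    constructor
    · rintro ⟨ζ, hζ, rfl, rfl⟩
      refine ⟨rfl, ?_⟩
      rw [add_sub_cancel_left, norm_mul, Complex.norm_real, Real.norm_of_nonneg he0.le]
      nlinarith
    · rintro ⟨rfl, hz⟩
      refine ⟨(z - x₀) / e, ?_, rfl, ?_⟩
      · rw [norm_div, Complex.norm_real, Real.norm_of_nonneg he0.le, div_lt_one he0]
        exact hz
      · field_simp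
        ring

/-- Iterates that are bounded on `D` and whose images of `D` shrink to points form a normal
family. -/
theorem iteratesNormalOn_of_diam_tendsto_zero {f : ℂ × ℂ → ℂ × ℂ} {D : Set (ℂ × ℂ)} {P₀ : ℂ × ℂ}
    {R : ℝ} (hR : ∀ j, ‖f^[j] P₀‖ ≤ R)
    (hdiam : ∀ ε > 0, ∃ J, ∀ j, J ≤ j → ∀ P ∈ D, dist (f^[j] P) (f^[j] P₀) ≤ ε) :
    IteratesNormalOn f D := by
  intro s
  -- If the times tend to infinity, a convergent subsequence at `P₀` gives a constant limit on `D`.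
  -- Otherwise some iterate occurs infinitely often.
  by_cases hs : Tendsto s atTop atTop
  · obtain ⟨G, -, σ, hσ, hG⟩ := (isCompact_closedBall (0 : ℂ × ℂ) R).tendsto_subseq
      (x := fun i => f^[s i] P₀) (fun i => by simpa using hR (s i))
    refine ⟨σ, hσ, fun _ => G, TendstoUniformlyOn.tendstoLocallyUniformlyOn ?_⟩
    rw [Metric.tendstoUniformlyOn_iff]
    intro ε hε
    obtain ⟨J, hJ⟩ := hdiam (ε / 2) (half_pos hε)
    have h1 := (hs.comp hσ.tendsto_atTop).eventually_ge_atTop J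
    have h2 := Metric.tendsto_nhds.mp hG (ε / 2) (half_pos hε)
    filter_upwards [h1, h2] with i hi1 hi2 P hP
    have h3 := hJ _ hi1 P hP
    rw [dist_comm]
    calc _ ≤ dist (f^[s (σ i)] P) (f^[s (σ i)] P₀) + dist (f^[s (σ i)] P₀) G :=
          dist_triangle _ _ _
      _ < ε := by
          simp only [Function.comp_apply] at h3 hi2
          linarith
  · obtain ⟨b, hb⟩ : ∃ b, ∃ᶠ i in atTop, s i < b := by
      simpa [tendsto_atTop, Filter.Frequently, not_forall] using hs
    obtain ⟨c, hc⟩ : ∃ c, ∃ᶠ i in atTop, s i = c := by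
      by_contra! hcon
      refine hb ?_
      have : ∀ᶠ i in atTop, ∀ c ∈ Finset.range b, s i ≠ c :=
        (Finset.eventually_all _).mpr fun c _ => hcon c
      filter_upwards [this] with i hi hlt
      exact hi (s i) (Finset.mem_range.mpr hlt) rfl
    obtain ⟨σ, hσ, hσc⟩ := extraction_of_frequently_atTop hc
    refine ⟨σ, hσ, f^[c], TendstoUniformlyOn.tendstoLocallyUniformlyOn ?_⟩
    rw [Metric.tendstoUniformlyOn_iff]
    intro ε hε
    filter_upwards with i P _
    rw [hσc i, dist_self]
    exact hε

/-! ### Passage through successive disks. -/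

theorem lemma5p7 (lam : ℂ) (hlam : 1 < ‖lam‖) (p q : Polynomial ℂ)
    (hp0 : p.eval 0 = 0) (hp1 : p.derivative.eval 0 = lam)
    (hq0 : q.eval 0 = 0) (hq1 : q.derivative.eval 0 ≠ 0)
    (x₀ : ℂ) (hcrit : 3 ≤ p.derivative.rootMultiplicity x₀)
    (k : ℕ) (hk : (fun z : ℂ => p.eval z)^[k] x₀ = 0)
    (hdeg : IsDegenerateResonant lam p q x₀ k)
    (w₀ : ℂ) (hw₀ : Tendsto (fun n : ℕ => phi lam p q x₀ n n w₀) atTop (𝓝 x₀)) :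
    ∃ N : ℕ, ∀ n : ℕ, N ≤ n →
      IsFatouDisk (skewProduct lam p q) (verticalDisk lam w₀ x₀ n) ∧
      TendstoUniformlyOn (fun (j : ℕ) (P : ℂ × ℂ) => ((skewProduct lam p q)^[j] P).1)
        (fun _ => 0) atTop (verticalDisk lam w₀ x₀ n) ∧
      ∃ R : ℝ, ∀ P ∈ verticalDisk lam w₀ x₀ n, ∀ j : ℕ,
        ‖((skewProduct lam p q)^[j] P).2‖ ≤ R := by
  have hlam0 : lam ≠ 0 := norm_pos_iff.mp (by linarith)
  obtain ⟨B, hB⟩ := hdeg.exists_norm_coeff_two_le hlam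
  -- Since `p` fixes `0`, the hitting time may be raised, which ensures it is positive as the
  -- separate first step requires.
  have hk' : (fun z : ℂ => p.eval z)^[k + 1] x₀ = 0 := by
    rw [Function.iterate_succ_apply', hk, hp0]
  obtain ⟨N, R, d, hN1, hd, hdyn⟩ := exists_verticalDisk_dynamics hlam hp0 hp1 hq0 hcrit
    (Nat.le_add_left 1 k) hk' (fun j hj => hB j (by omega)) hw₀
  have hpass : ∀ n, N ≤ n → ∀ z : ℂ, ∀ j, n ≤ j → fiberOrbit lam p q (w₀ / lam ^ n) z j
      = fiberOrbit lam p q (w₀ / lam ^ (2 * n)) (fiberOrbit lam p q (w₀ / lam ^ n) z n)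
        (j - n) := by
    intro n _ z j hj
    conv_lhs => rw [← Nat.add_sub_cancel' hj, fiberOrbit_add, div_div, ← pow_add, ← two_mul]
  have hbdd : ∀ j n, N ≤ n → ∀ z : ℂ, ‖z - x₀‖ < ‖lam‖ ^ (-(3 * (n : ℝ) / 4)) →
      ‖fiberOrbit lam p q (w₀ / lam ^ n) z j‖ ≤ R := by
    intro j
    induction j using Nat.strong_induction_on with
    | _ j ih =>
      intro n hn z hz
      rcases le_or_gt j n with h | h
      · exact ((hdyn n hn z hz).1 j h).1
      · rw [hpass n hn z j h.le]
        exact ih (j - n) (by omega) (2 * n) (by omega) _ (hdyn n hn z hz).2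
  have hsmall : ∀ ε > 0, ∃ N', ∀ j n, N ≤ n → N' ≤ n → ∀ z z' : ℂ,
      ‖z - x₀‖ < ‖lam‖ ^ (-(3 * (n : ℝ) / 4)) → ‖z' - x₀‖ < ‖lam‖ ^ (-(3 * (n : ℝ) / 4)) →
      ‖fiberOrbit lam p q (w₀ / lam ^ n) z j - fiberOrbit lam p q (w₀ / lam ^ n) z' j‖ ≤ ε := by
    intro ε hε
    obtain ⟨N', hN'⟩ := eventually_atTop.mp (hd.eventually_lt_const (half_pos hε))
    refine ⟨N', fun j => ?_⟩
    induction j using Nat.strong_induction_on with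
    | _ j ih =>
      intro n hn hn' z z' hz hz'
      rcases le_or_gt j n with h | h
      · have h1 := ((hdyn n hn z hz).1 j h).2
        have h2 := ((hdyn n hn z' hz').1 j h).2
        have h3 := hN' n hn'
        rw [← sub_sub_sub_cancel_right _ _ (fiberOrbit lam p q (w₀ / lam ^ n) x₀ j)]
        exact (norm_sub_le _ _).trans (by linarith)
      · rw [hpass n hn z j h.le, hpass n hn z' j h.le]
        exact ih (j - n) (by omega) (2 * n) (by omega) (by omega) _ _ (hdyn n hn z hz).2
          (hdyn n hn z' hz').2
  have hshrink : ∀ ε > 0, ∀ n, N ≤ n → ∃ J, ∀ j, J ≤ j → ∀ z z' : ℂ,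
      ‖z - x₀‖ < ‖lam‖ ^ (-(3 * (n : ℝ) / 4)) → ‖z' - x₀‖ < ‖lam‖ ^ (-(3 * (n : ℝ) / 4)) →
      ‖fiberOrbit lam p q (w₀ / lam ^ n) z j - fiberOrbit lam p q (w₀ / lam ^ n) z' j‖ ≤ ε := by
    intro ε hε
    obtain ⟨N', hN'⟩ := hsmall ε hε
    -- Induction on the deficit `N' - n`: since `1 ≤ N ≤ n`, passing from `n` to `2 * n` lowers it
    -- by at least one until the uniform bound of `hsmall` applies.
    have key : ∀ l n, N ≤ n → N' - n ≤ l → ∃ J, ∀ j, J ≤ j → ∀ z z' : ℂ,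
      ‖z - x₀‖ < ‖lam‖ ^ (-(3 * (n : ℝ) / 4)) → ‖z' - x₀‖ < ‖lam‖ ^ (-(3 * (n : ℝ) / 4)) →
      ‖fiberOrbit lam p q (w₀ / lam ^ n) z j
        - fiberOrbit lam p q (w₀ / lam ^ n) z' j‖ ≤ ε := by
      intro l
      induction l with
      | zero => exact fun n hn hl => ⟨0, fun j _ => hN' j n hn (by omega)⟩
      | succ l ih =>
        intro n hn hl
        obtain ⟨J, hJ⟩ := ih (2 * n) (by omega) (by omega)
        refine ⟨n + J, fun j hj z z' hz hz' => ?_⟩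
        rw [hpass n hn z j (by omega), hpass n hn z' j (by omega)]
        exact hJ (j - n) (by omega) _ _ (hdyn n hn z hz).2 (hdyn n hn z' hz').2
    exact fun n hn => key (N' - n) n hn le_rfl
  refine ⟨N, fun n hn => ?_⟩
  have hbound : ∀ P ∈ verticalDisk lam w₀ x₀ n, ∀ j : ℕ,
      ‖((skewProduct lam p q)^[j] P).2‖ ≤ R := by
    rintro ⟨u, z⟩ ⟨rfl, hz⟩ j
    exact hbdd j n hn z hz
  have hcenter : (w₀ / lam ^ n, x₀) ∈ verticalDisk lam w₀ x₀ n := by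
    refine ⟨rfl, ?_⟩
    rw [sub_self, norm_zero]
    exact Real.rpow_pos_of_pos (norm_pos_iff.mpr hlam0) _
  have hfst : ∀ j, ‖w₀ / lam ^ n / lam ^ j‖ ≤ ‖w₀ / lam ^ n‖ := fun j => by
    rw [norm_div _ (lam ^ j), norm_pow]
    exact div_le_self (norm_nonneg _) (one_le_pow₀ hlam.le)
  refine ⟨⟨isHolomorphicDisk_verticalDisk hlam0 w₀ x₀ n, ?_⟩, ?_, R, hbound⟩
  · refine iteratesNormalOn_of_diam_tendsto_zero (P₀ := (w₀ / lam ^ n, x₀)) (R := max ‖w₀ / lam ^ n‖ R)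
      (fun j => ?_) fun ε hε => ?_
    · rw [Prod.norm_def]
      refine max_le_max ?_ (hbound _ hcenter j)
      rw [skewProduct_iterate_fst]
      exact hfst j
    · obtain ⟨J, hJ⟩ := hshrink ε hε n hn
      refine ⟨J, fun j hj => ?_⟩
      rintro ⟨u, z⟩ ⟨rfl, hz⟩
      rw [skewProduct_iterate_eq, skewProduct_iterate_eq, Prod.dist_eq]
      refine max_le (by simpa using hε.le) ?_
      rw [dist_eq_norm]
      exact hJ j hj z x₀ hz hcenter.2
  · rw [Metric.tendstoUniformlyOn_iff]
    intro ε hε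
    have hlim : Tendsto (fun j : ℕ => ‖w₀ / lam ^ n‖ / ‖lam‖ ^ j) atTop (𝓝 0) :=
      tendsto_const_nhds.div_atTop (tendsto_pow_atTop_atTop_of_one_lt hlam)
    filter_upwards [hlim.eventually_lt_const hε] with j hj
    rintro ⟨u, z⟩ ⟨rfl, hz⟩
    rw [skewProduct_iterate_fst, dist_zero_left, norm_div _ (lam ^ j), norm_pow]
    exact hj
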